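/- Let $\mathcal X\subset\mathbb R^d$ be finite and non-empty, let $k:\mathcal X\times\mathcal X\to\mathbb R$ be a stationary kernel with $k(x,x)=1$ for all $x$, and let $f\sim\mathcal{GP}(0,k)$ be a Gaussian process on $\mathcal X$ with mean zero and covariance $k$. Querying a point $x_t$ returns $y_t=f(x_t)+\epsilon_t$, where $\epsilon_1,\epsilon_2,\dots$ are i.i.d. $\mathcal N(0,\sigma^2)$ with $\sigma>0$, independent of $f$. For $t\ge 1$ let $\mu_{t-1}(x)=\mathbf k_{t-1}(x)^\top(\mathbf K+\sigma^2 I)^{-1}\mathbf y_{t-1}$ and $\sigma_{t-1}^2(x)=k(x,x)-\mathbf k_{t-1}(x)^\top(\mathbf K+\sigma^2 I)^{-1}\mathbf k_{t-1}(x)$ be the posterior mean and variance of $f(x)$ given $(x_i,y_i)_{i<t}$, where $\mathbf k_{t-1}(x)=(k(x,x_i))_{i<t}$, $\mathbf K=(k(x_i,x_j))_{i,j<t}$ and $\mathbf y_{t-1}=(y_i)_{i<t}$. The algorithm IRGP-UCB chooses $$x_t\in\operatorname*{arg\,max}_{x\in\mathcal X}\ \mu_{t-1}(x)+\zeta_t^{1/2}\sigma_{t-1}(x),\qquad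 t=1,2,\dots,$$ where $\zeta_t=s+Z_t$ with $s=2\log(|\mathcal X|/2)$ and $Z_1,Z_2,\dots$ i.i.d. exponential with rate $1/2$, independent of $f$ and $(\epsilon_t)_t$. Ties are broken using only the history $(x_i,y_i)_{i<t}$, $(\zeta_i)_{i\le t}$ and possibly extra randomness independent of $f$, $(\epsilon_t)_t$ and $(\zeta_t)_t$. (If $|\mathcal X|=1$, then $\zeta_t^{1/2}$ may be undefined; it is then read as $0$, and the choice of $x_t$ is trivial.) Let $x^*\in\operatorname{arg\,max}_{x\in\mathcal X}f(x)$ and let $$\mathrm{BSR}_T=\mathbb E\Bigl[f(x^*)-\max_{t\le T}f(x_t)\Bigr]$$ be the Bayesian simple regret. Let $$\gamma_T=\max_{a_1,\dots,a_T\in\mathcal X} I\bigl((f(a_i)+\epsilon_i)_{i\le T};\,(f(a_i))_{i\le T}\bigr)$$ be the maximum information gain, where the points $a_i$ may repeat and $I$ is the Shannon mutual information in nats. Put $C_1=2/\log(1+\sigma^{-2})$ and $C_2=2+s$. Then for every $\eta>0$ there is a smallest positive integer $T$ with $$\sqrt{\frac{C_1C_2\gamma_T}{T}}\le\eta ,$$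 and for this $T$ one has $\mathrm{BSR}_T\le\eta$ (the expectation being well defined); that is, IRGP-UCB reaches Bayesian simple regret at most $\eta$ within at most $T$ function evaluations. -/

import Mathlib

open MeasureTheory ProbabilityTheory
open scoped ENNReal NNReal Matrix

namespace GPBandit

/-! Evaluations are numbered `0, 1, 2, …`: the query with index `t` is the `(t + 1)`-st one and is
chosen from the `t` data points with indices `0, …, t - 1`. -/

section Posterior

variable {X : Type*}

/-- A kernel on a finite set of points of `ℝᵈ` is stationary if `k x x'` depends on `x - x'` only. -/
def IsStationary {d : ℕ} {D : Finset (EuclideanSpace ℝ (Fin d))} (k : D → D → ℝ) : Prop :=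
  ∃ φ : EuclideanSpace ℝ (Fin d) → ℝ,
    ∀ x x' : D, k x x' = φ ((x : EuclideanSpace ℝ (Fin d)) - (x' : EuclideanSpace ℝ (Fin d)))

/-- The vector `(k(x, a₀), …, k(x, a_{t-1}))`. -/
def kernelVec (k : X → X → ℝ) {t : ℕ} (a : Fin t → X) (x : X) : Fin t → ℝ :=
  fun i => k x (a i)

/-- The kernel matrix of the points `a₀, …, a_{t-1}`. -/
def kernelMatrix (k : X → X → ℝ) {t : ℕ} (a : Fin t → X) : Matrix (Fin t) (Fin t) ℝ :=
  Matrix.of fun i j => k (a i) (a j)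

/-- Posterior mean `k(x)ᵀ (K + σ² I)⁻¹ y`. -/
noncomputable def postMean (k : X → X → ℝ) (σ : ℝ) {t : ℕ} (a : Fin t → X) (y : Fin t → ℝ)
    (x : X) : ℝ :=
  kernelVec k a x ⬝ᵥ
    ((kernelMatrix k a + σ ^ 2 • (1 : Matrix (Fin t) (Fin t) ℝ))⁻¹ *ᵥ y)

/-- Posterior variance `k(x, x) - k(x)ᵀ (K + σ² I)⁻¹ k(x)`. -/
noncomputable def postVar (k : X → X → ℝ) (σ : ℝ) {t : ℕ} (a : Fin t → X) (x : X) : ℝ :=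
  k x x - kernelVec k a x ⬝ᵥ
    ((kernelMatrix k a + σ ^ 2 • (1 : Matrix (Fin t) (Fin t) ℝ))⁻¹ *ᵥ kernelVec k a x)

/-- The upper confidence bound `μ(x) + ζ^{1/2} σ(x)` computed from the data `(aᵢ, yᵢ)`, where
`σ(x)` is the posterior standard deviation. -/
noncomputable def ucb (k : X → X → ℝ) (σ : ℝ) {t : ℕ} (a : Fin t → X) (y : Fin t → ℝ) (ζ : ℝ)
    (x : X) : ℝ :=
  postMean k σ a y x + √ζ * √(postVar k σ a x)

end Posterior

/-- The two-parameter exponential distribution: the law of `s + Z` with `Z ∼ Exp(lam)`. -/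
noncomputable def twoParamExp (s lam : ℝ) : Measure ℝ :=
  (expMeasure lam).map (fun z => s + z)

section Model

variable {Ω X 𝒰 : Type*} [MeasurableSpace Ω]

/-- `f` is a Gaussian process with mean zero and covariance `k`, `ε` is a sequence of i.i.d.
`N(0, σ²)` variables, and `f` and `ε` are independent. -/
structure IsGPModel (P : Measure Ω) (k : X → X → ℝ) (σ : ℝ) (f : X → Ω → ℝ) (ε : ℕ → Ω → ℝ) :
    Prop where
  measurable_f : ∀ x, Measurable (f x)
  gaussian_f : IsGaussianProcess f P
  mean_f : ∀ x, ∫ ω, f x ω ∂P = 0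
  cov_f : ∀ x x', covariance (f x) (f x') P = k x x'
  measurable_noise : ∀ t, Measurable (ε t)
  law_noise : ∀ t, HasLaw (ε t) (gaussianReal 0 (σ ^ 2).toNNReal) P
  iIndep_noise : iIndepFun ε P
  indep_f_noise : IndepFun (fun ω x => f x ω) (fun ω t => ε t ω) P

/-- The observation `y_t = f(x_t) + ε_t`. -/
def obs (f : X → Ω → ℝ) (ε : ℕ → Ω → ℝ) (x : ℕ → Ω → X) (t : ℕ) (ω : Ω) : ℝ :=
  f (x t ω) ω + ε t ω

/-- Everything the algorithm knows when it chooses its query with index `t`: its internal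
randomness `U` for breaking ties, `ζ₀, …, ζ_t`, and the data `(xᵢ, yᵢ)`, `i < t`. -/
def history (f : X → Ω → ℝ) (ε ζ : ℕ → Ω → ℝ) (U : Ω → 𝒰) (x : ℕ → Ω → X) (t : ℕ) (ω : Ω) :
    𝒰 × (Fin (t + 1) → ℝ) × (Fin t → X) × (Fin t → ℝ) :=
  (U ω, fun i => ζ i ω, fun i => x i ω, fun i => obs f ε x i ω)

/-- `x` is the sequence of queries of IRGP-UCB with parameters `s` and `lam`. The `ζ_t` are drawn
independently of each other and of everything else from the two-parameter exponential
distribution, and `x_t` is a maximizer of the upper confidence bound with parameter `ζ_t`. Ties may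
be broken in any non-anticipating way, possibly with the help of a random element `U` that is
independent of `f`, `ε` and `ζ`. -/
structure IsIRGPUCB [MeasurableSpace X] [MeasurableSpace 𝒰] (P : Measure Ω) (k : X → X → ℝ)
    (σ s lam : ℝ) (f : X → Ω → ℝ) (ε ζ : ℕ → Ω → ℝ) (U : Ω → 𝒰) (x : ℕ → Ω → X) : Prop where
  measurable_zeta : ∀ t, Measurable (ζ t)
  law_zeta : ∀ t, HasLaw (ζ t) (twoParamExp s lam) P
  iIndep_zeta : iIndepFun ζ P
  measurable_U : Measurable U
  indep_zeta_U : IndepFun (fun ω t => ζ t ω) U P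
  indep_env : IndepFun (fun ω => ((fun x => f x ω : X → ℝ), (fun t => ε t ω : ℕ → ℝ)))
    (fun ω => ((fun t => ζ t ω : ℕ → ℝ), U ω)) P
  nonanticipating : ∀ t, Measurable[MeasurableSpace.comap (history f ε ζ U x t) inferInstance] (x t)
  argmax : ∀ t ω x', ucb k σ (fun i : Fin t => x i ω) (fun i : Fin t => obs f ε x i ω) (ζ t ω) x' ≤
    ucb k σ (fun i : Fin t => x i ω) (fun i : Fin t => obs f ε x i ω) (ζ t ω) (x t ω)

/-- Shannon mutual information `I(Y; Z)` (in nats): the Kullback-Leibler divergence of the joint law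
from the product of the marginal laws. -/
noncomputable def mutualInfo {E F : Type*} [MeasurableSpace E] [MeasurableSpace F]
    (P : Measure Ω) (Y : Ω → E) (Z : Ω → F) : ℝ≥0∞ :=
  InformationTheory.klDiv (P.map fun ω => (Y ω, Z ω)) ((P.map Y).prod (P.map Z))

/-- Maximum information gain: the largest `I(y_A; f_A)` over all choices of `T` points
`a₀, …, a_{T-1}` of the domain, repetitions allowed, with `f_A = (f(aᵢ))ᵢ` and
`y_A = (f(aᵢ) + εᵢ)ᵢ`. It depends on `f` and `ε` through their law only. -/
noncomputable def maxInfoGain (P : Measure Ω) (f : X → Ω → ℝ) (ε : ℕ → Ω → ℝ) (T : ℕ) : ℝ≥0∞ :=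
  ⨆ a : Fin T → X,
    mutualInfo P (fun ω (i : Fin T) => f (a i) ω + ε i ω) (fun ω (i : Fin T) => f (a i) ω)

/-- The simple regret `max_x f(x) - max_{t < T} f(x_t)`, for a finite non-empty domain and
`T` positive. -/
noncomputable def simpleRegret (f : X → Ω → ℝ) (x : ℕ → Ω → X) (T : ℕ) (ω : Ω) : ℝ :=
  (⨆ x' : X, f x' ω) - ⨆ t : Fin T, f (x t ω) ω

/-- The Bayesian simple regret after `T` evaluations. -/
noncomputable def BSR (P : Measure Ω) (f : X → Ω → ℝ) (x : ℕ → Ω → X) (T : ℕ) : ℝ :=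
  ∫ ω, simpleRegret f x T ω ∂P

end Model

end GPBandit

/-!
Write `f` as its posterior mean given `t` noisy values at fixed points plus a residual. The residual
is Gaussian with the posterior variance and independent of the data. Comparing the union bound for
Gaussian tails with the exponential tail of `ζ_t`, which is shifted by `s` precisely to absorb the
factor `|X| / 2`, gives `𝔼 max f ≤ 𝔼 max UCB` conditionally on the data along every fixed path of
queries. As the residual at the query has mean zero, the expected regret of round `t` is at most
`𝔼 √ζ_t σ_{t-1}(x_t)`, and by the Cauchy-Schwarz inequality these bounds sum to at most
`√(T 𝔼 ζ) · √(𝔼 ∑ σ²_{t-1}(x_t))`. Factoring `det (I + σ⁻² K)` into Schur complements bounds the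
last sum by `C₁ γ_T`. Finally `γ_T = O(log T)`, since by Sylvester's identity `det (I + σ⁻² K)` is
the determinant of a matrix of size `|X|`, so that the threshold is eventually met.
-/

namespace GPBandit

section Density

theorem map_withDensity_comp {α β : Type*} [MeasurableSpace α] [MeasurableSpace β] {μ : Measure α}
    {φ : α → β} (hφ : Measurable φ) {g : β → ℝ≥0∞} (hg : Measurable g) :
    (μ.withDensity fun x => g (φ x)).map φ = (μ.map φ).withDensity g := by
  ext s hs
  rw [Measure.map_apply hφ hs, withDensity_apply _ (hφ hs), withDensity_apply _ hs,
    setLIntegral_map hs hg hφ]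

theorem pi_withDensity {ι : Type*} [Fintype ι] {α : ι → Type*} [∀ i, MeasurableSpace (α i)]
    {μ : ∀ i, Measure (α i)} [∀ i, SigmaFinite (μ i)] {g : ∀ i, α i → ℝ}
    (hg0 : ∀ i x, 0 ≤ g i x) (hg : ∀ i, Integrable (g i) (μ i)) :
    Measure.pi (fun i => (μ i).withDensity fun x => ENNReal.ofReal (g i x)) =
      (Measure.pi μ).withDensity fun x => ENNReal.ofReal (∏ i, g i (x i)) := by
  have : ∀ i, IsFiniteMeasure ((μ i).withDensity fun x => ENNReal.ofReal (g i x)) :=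
    fun i => isFiniteMeasure_withDensity_ofReal (hg i).2
  refine Measure.pi_eq fun s hs => ?_
  have hms : MeasurableSet (Set.univ.pi s) := MeasurableSet.univ_pi hs
  have hprod (x : ∀ i, α i) : (Set.univ.pi s).indicator (fun x => ∏ i, g i (x i)) x =
      ∏ i, (s i).indicator (g i) (x i) := by
    classical
    simp only [Set.indicator_apply, Set.mem_pi, Set.mem_univ, true_implies, Finset.prod_ite_zero,
      Finset.mem_univ]
  have hint : Integrable (fun x : ∀ i, α i => ∏ i, g i (x i)) (Measure.pi μ) :=
    Integrable.fintype_prod_dep hg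
  rw [withDensity_apply _ hms, ← ofReal_integral_eq_lintegral_ofReal hint.integrableOn
    (.of_forall fun x => Finset.prod_nonneg fun i _ => hg0 i _), ← integral_indicator hms]
  simp_rw [hprod]
  rw [integral_fintype_prod_eq_prod, ENNReal.ofReal_prod_of_nonneg fun i _ =>
      integral_nonneg fun x => Set.indicator_nonneg (fun x _ => hg0 i x) x]
  refine Finset.prod_congr rfl fun i _ => ?_
  rw [withDensity_apply _ (hs i), integral_indicator (hs i),
    ofReal_integral_eq_lintegral_ofReal (hg i).integrableOn (.of_forall (hg0 i))]

theorem klDiv_withDensity_ofReal {α : Type*} [MeasurableSpace α] {μ ν : Measure α}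
    [IsProbabilityMeasure μ] [IsProbabilityMeasure ν] {g : α → ℝ} (hg : Measurable g)
    (hpos : ∀ x, 0 < g x) (h : μ = ν.withDensity fun x => ENNReal.ofReal (g x))
    (hint : Integrable (fun x => Real.log (g x)) μ) :
    InformationTheory.klDiv μ ν = ENNReal.ofReal (∫ x, Real.log (g x) ∂μ) := by
  have hac : μ ≪ ν := h ▸ withDensity_absolutelyContinuous _ _
  have hllr : llr μ ν =ᵐ[μ] fun x => Real.log (g x) := by
    have hrn := hac.ae_le (h ▸ Measure.rnDeriv_withDensity ν hg.ennreal_ofReal)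
    filter_upwards [hrn] with x hx
    rw [llr, hx, ENNReal.toReal_ofReal (hpos x).le]
  rw [InformationTheory.klDiv_of_ac_of_integrable hac (hint.congr hllr.symm),
    integral_congr_ae hllr]
  simp

end Density

section AdditiveNoise

variable {Ω G : Type*} [MeasurableSpace Ω] {P : Measure Ω} [IsProbabilityMeasure P]
  [AddCommGroup G] [MeasurableSpace G] [MeasurableAdd₂ G]

theorem measurePreserving_add_prod_snd {μ ν : Measure G} [SFinite μ] [SFinite ν]
    [μ.IsAddRightInvariant] :
    MeasurePreserving (fun z : G × G => (z.1 + z.2, z.2)) (μ.prod ν) (μ.prod ν) := by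
  have hmeas : Measurable fun z : G × G => (z.1 + z.2, z.2) := by fun_prop
  refine ⟨hmeas, Measure.ext fun s hs => ?_⟩
  rw [Measure.map_apply hmeas hs, Measure.prod_apply_symm (hmeas hs), Measure.prod_apply_symm hs]
  exact lintegral_congr fun y => measure_preimage_add_right μ y ((fun x => (x, y)) ⁻¹' s)

variable [MeasurableSub₂ G] {ν : Measure G} [SFinite ν] [ν.IsAddRightInvariant]
  {F e : Ω → G} {p q : G → ℝ}

theorem map_add_prodMk_eq_withDensity (hF : Measurable F) (he : Measurable e)
    (hFe : IndepFun F e P) (hp : Measurable p) (hp0 : ∀ y, 0 < p y) (hq : Measurable q)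
    (hlaw : P.map (fun ω => F ω + e ω) = ν.withDensity fun y => ENNReal.ofReal (p y))
    (hlaw_e : P.map e = ν.withDensity fun y => ENNReal.ofReal (q y)) :
    P.map (fun ω => (F ω + e ω, F ω)) =
      ((P.map fun ω => F ω + e ω).prod (P.map F)).withDensity
        fun z => ENNReal.ofReal (q (z.1 - z.2) / p z.1) := by
  have : IsProbabilityMeasure (P.map F) := Measure.isProbabilityMeasure_map hF.aemeasurable
  let shear : G × G → G × G := fun z => (z.1 + z.2, z.2)
  have hshear : Measurable shear := by fun_prop
  have hsub : Measurable fun z : G × G => ENNReal.ofReal (q (z.1 - z.2)) := by fun_prop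
  calc P.map (fun ω => (F ω + e ω, F ω)) = (P.map fun ω => (e ω, F ω)).map shear := by
        rw [Measure.map_map hshear (he.prodMk hF)]
        simp only [shear, Function.comp_def, add_comm]
    _ = ((ν.prod (P.map F)).withDensity
          fun z => ENNReal.ofReal (q ((shear z).1 - (shear z).2))).map shear := by
        rw [(indepFun_iff_map_prod_eq_prod_map_map he.aemeasurable hF.aemeasurable).1 hFe.symm,
          hlaw_e, prod_withDensity_left hq.ennreal_ofReal]
        simp only [shear, add_sub_cancel_right]
    _ = (ν.prod (P.map F)).withDensity fun z => ENNReal.ofReal (q (z.1 - z.2)) := by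
        rw [map_withDensity_comp hshear hsub, measurePreserving_add_prod_snd.map_eq]
    _ = _ := by
        rw [hlaw, prod_withDensity_left hp.ennreal_ofReal,
          ← withDensity_mul _ (by fun_prop) (by fun_prop)]
        congr 1 with z
        rw [Pi.mul_apply, ← ENNReal.ofReal_mul (hp0 _).le, mul_div_cancel₀ _ (hp0 _).ne']

theorem mutualInfo_add_self_right (hF : Measurable F) (he : Measurable e)
    (hFe : IndepFun F e P) (hp : Measurable p) (hp0 : ∀ y, 0 < p y) (hq : Measurable q)
    (hq0 : ∀ y, 0 < q y)
    (hlaw : P.map (fun ω => F ω + e ω) = ν.withDensity fun y => ENNReal.ofReal (p y))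
    (hlaw_e : P.map e = ν.withDensity fun y => ENNReal.ofReal (q y))
    (hpi : Integrable (fun ω => Real.log (p (F ω + e ω))) P)
    (hqi : Integrable (fun ω => Real.log (q (e ω))) P) :
    mutualInfo P (fun ω => F ω + e ω) F =
      ENNReal.ofReal (∫ ω, Real.log (q (e ω)) ∂P - ∫ ω, Real.log (p (F ω + e ω)) ∂P) := by
  have hY : Measurable fun ω => F ω + e ω := hF.add he
  have hjoint : Measurable fun ω => (F ω + e ω, F ω) := hY.prodMk hF
  have : IsProbabilityMeasure (P.map F) := Measure.isProbabilityMeasure_map hF.aemeasurable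
  have : IsProbabilityMeasure (P.map fun ω => F ω + e ω) :=
    Measure.isProbabilityMeasure_map hY.aemeasurable
  have : IsProbabilityMeasure (P.map fun ω => (F ω + e ω, F ω)) :=
    Measure.isProbabilityMeasure_map hjoint.aemeasurable
  have hg : Measurable fun z : G × G => q (z.1 - z.2) / p z.1 := by fun_prop
  have hlog (ω : Ω) : Real.log (q (F ω + e ω - F ω) / p (F ω + e ω)) =
      Real.log (q (e ω)) - Real.log (p (F ω + e ω)) := by
    rw [add_sub_cancel_left, Real.log_div (hq0 _).ne' (hp0 _).ne']
  rw [mutualInfo, klDiv_withDensity_ofReal hg (fun z => div_pos (hq0 _) (hp0 _))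
    (map_add_prodMk_eq_withDensity hF he hFe hp hp0 hq hlaw hlaw_e),
    integral_map hjoint.aemeasurable hg.log.aestronglyMeasurable]
  · simp_rw [hlog]
    rw [integral_sub hqi hpi]
  · rw [integrable_map_measure hg.log.aestronglyMeasurable hjoint.aemeasurable]
    exact (hqi.sub hpi).congr (.of_forall fun ω => (hlog ω).symm)

end AdditiveNoise

section CenteredGaussian

variable {Ω ι κ : Type*} [MeasurableSpace Ω] {P : Measure Ω}

/-- `Y` is a centred Gaussian vector with covariance matrix `S`, which may be singular. -/
structure HasCenteredGaussianLaw (Y : ι → Ω → ℝ) (S : Matrix ι ι ℝ) (P : Measure Ω) : Prop where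
  gaussian : HasGaussianLaw (fun ω i => Y i ω) P
  integral_eq_zero : ∀ i, ∫ ω, Y i ω ∂P = 0
  covariance_eq : ∀ i j, covariance (Y i) (Y j) P = S i j

namespace HasCenteredGaussianLaw

variable {Y Z : ι → Ω → ℝ} {S R : Matrix ι ι ℝ}

theorem memLp_two (hY : HasCenteredGaussianLaw Y S P) (i : ι) : MemLp (Y i) 2 P :=
  (hY.gaussian.eval i).memLp_two

theorem integrable (hY : HasCenteredGaussianLaw Y S P) (i : ι) : Integrable (Y i) P :=
  (hY.gaussian.eval i).integrable

theorem aemeasurable (hY : HasCenteredGaussianLaw Y S P) (i : ι) : AEMeasurable (Y i) P :=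
  (hY.gaussian.eval i).aemeasurable

theorem map_eval (hY : HasCenteredGaussianLaw Y S P) (i : ι) :
    P.map (Y i) = gaussianReal 0 (S i i).toNNReal := by
  rw [(hY.gaussian.eval i).map_eq_gaussianReal, hY.integral_eq_zero, ← hY.covariance_eq,
    covariance_self (hY.aemeasurable i)]

theorem integral_sq (hY : HasCenteredGaussianLaw Y S P) (i : ι) : ∫ ω, Y i ω ^ 2 ∂P = S i i := by
  rw [← hY.covariance_eq, covariance_self (hY.aemeasurable i),
    variance_of_integral_eq_zero (hY.aemeasurable i) (hY.integral_eq_zero i)]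

theorem mulVec [Fintype ι] [Finite κ] (hY : HasCenteredGaussianLaw Y S P) (B : Matrix κ ι ℝ) :
    HasCenteredGaussianLaw (fun i ω => (B *ᵥ fun j => Y j ω) i) (B * S * Bᵀ) P where
  gaussian :=
    have := Fintype.ofFinite κ
    hY.gaussian.map_fun B.mulVecLin.toContinuousLinearMap
  integral_eq_zero i := by
    simp only [Matrix.mulVec, dotProduct]
    rw [integral_finsetSum _ fun j _ => (hY.integrable j).const_mul _]
    simp [integral_const_mul, hY.integral_eq_zero]
  covariance_eq i j := by
    have := hY.gaussian.isProbabilityMeasure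
    simp only [Matrix.mulVec, dotProduct]
    rw [covariance_fun_sum_fun_sum (fun l => (hY.memLp_two l).const_mul _)
      (fun l => (hY.memLp_two l).const_mul _), Matrix.mul_apply]
    simp only [covariance_const_mul_left, covariance_const_mul_right, hY.covariance_eq,
      Matrix.mul_apply, Matrix.transpose_apply, Finset.sum_mul]
    rw [Finset.sum_comm]
    exact Finset.sum_congr rfl fun _ _ => Finset.sum_congr rfl fun _ _ => by ring

theorem of_iIndepFun [Finite ι] [DecidableEq ι] {e : ι → Ω → ℝ} {v : ℝ≥0}
    (hlaw : ∀ i, HasLaw (e i) (gaussianReal 0 v) P) (he : iIndepFun e P) :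
    HasCenteredGaussianLaw e ((v : ℝ) • (1 : Matrix ι ι ℝ)) P where
  gaussian := he.hasGaussianLaw fun i => (hlaw i).hasGaussianLaw
  integral_eq_zero i := by rw [(hlaw i).integral_eq, integral_id_gaussianReal]
  covariance_eq i j := by
    rcases eq_or_ne i j with rfl | hij
    · rw [covariance_self (hlaw i).aemeasurable, (hlaw i).variance_eq, variance_id_gaussianReal]
      simp
    · have := he.isProbabilityMeasure
      rw [(he.indepFun hij).covariance_eq_zero (hlaw i).hasGaussianLaw.memLp_two
        (hlaw j).hasGaussianLaw.memLp_two]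
      simp [hij]

theorem add_of_indepFun [Finite ι] (hY : HasCenteredGaussianLaw Y S P)
    (hZ : HasCenteredGaussianLaw Z R P)
    (h : IndepFun (fun ω i => Y i ω) (fun ω i => Z i ω) P) :
    HasCenteredGaussianLaw (fun i ω => Y i ω + Z i ω) (S + R) P where
  gaussian :=
    have := Fintype.ofFinite ι
    (h.hasGaussianLaw hY.gaussian hZ.gaussian).fun_add
  integral_eq_zero i := by
    rw [integral_add (hY.integrable i) (hZ.integrable i), hY.integral_eq_zero,
      hZ.integral_eq_zero, add_zero]
  covariance_eq i j := by
    have := hY.gaussian.isProbabilityMeasure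
    have hcross (i j : ι) : covariance (Y i) (Z j) P = 0 :=
      (h.comp (measurable_pi_apply i) (measurable_pi_apply j)).covariance_eq_zero
        (hY.memLp_two i) (hZ.memLp_two j)
    change covariance (Y i + Z i) (Y j + Z j) P = S i j + R i j
    rw [covariance_add_left (hY.memLp_two i) (hZ.memLp_two i)
        ((hY.memLp_two j).add (hZ.memLp_two j)),
      covariance_add_right (hY.memLp_two i) (hY.memLp_two j) (hZ.memLp_two j),
      covariance_add_right (hZ.memLp_two i) (hY.memLp_two j) (hZ.memLp_two j),
      hY.covariance_eq, hZ.covariance_eq, hcross, covariance_comm, hcross]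
    simp

theorem posSemidef [Finite ι] (hY : HasCenteredGaussianLaw Y S P) : S.PosSemidef := by
  have := Fintype.ofFinite ι
  refine .of_dotProduct_mulVec_nonneg (.ext fun i j => ?_) fun c => ?_
  · rw [star_trivial, ← hY.covariance_eq, ← hY.covariance_eq, covariance_comm]
  · have hc := hY.mulVec (Matrix.of fun _ : Unit => c)
    have hvar := hc.integral_sq ()
    rw [star_trivial, Matrix.dotProduct_mulVec]
    exact (integral_nonneg fun ω => sq_nonneg _).trans_eq hvar

theorem map_eq_pi [Fintype ι] [DecidableEq ι] (hY : HasCenteredGaussianLaw Y 1 P) :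
    P.map (fun ω i => Y i ω) = Measure.pi fun _ => gaussianReal 0 1 := by
  have hind : iIndepFun Y P := hY.gaussian.iIndepFun_of_covariance_eq_zero fun i j hij => by
    rw [hY.covariance_eq, Matrix.one_apply_ne hij]
  have := hY.gaussian.isProbabilityMeasure
  rw [(iIndepFun_iff_map_fun_eq_pi_map hY.aemeasurable).1 hind]
  simp [hY.map_eval]

end HasCenteredGaussianLaw

theorem measurable_mulVec [Fintype ι] (M : Matrix κ ι ℝ) : Measurable fun y : ι → ℝ => M *ᵥ y :=
  measurable_pi_lambda _ fun i => by
    simp only [Matrix.mulVec, dotProduct]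
    fun_prop

open scoped MatrixOrder in
theorem exists_mul_mul_transpose_eq_one [Fintype ι] [DecidableEq ι] {S : Matrix ι ι ℝ}
    (hS : S.PosDef) : ∃ B : Matrix ι ι ℝ, B * S * Bᵀ = 1 := by
  obtain ⟨A, hA⟩ := CStarAlgebra.nonneg_iff_eq_star_mul_self.mp hS.posSemidef.nonneg
  rw [Matrix.star_eq_conjTranspose, Matrix.conjTranspose_eq_transpose_of_trivial] at hA
  have hdet : IsUnit A.det := by
    have h := hS.det_pos
    rw [hA, Matrix.det_mul, Matrix.det_transpose] at h
    exact isUnit_iff_ne_zero.mpr (left_ne_zero_of_mul h.ne')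
  refine ⟨(A⁻¹)ᵀ, ?_⟩
  rw [Matrix.transpose_transpose, hA, ← Matrix.mul_assoc, ← Matrix.transpose_mul,
    Matrix.mul_nonsing_inv _ hdet, Matrix.transpose_one, Matrix.one_mul,
    Matrix.mul_nonsing_inv _ hdet]

section Whitening

variable [Fintype ι] [DecidableEq ι] {B S : Matrix ι ι ℝ} {Y : ι → Ω → ℝ}

/-- The density of a centred Gaussian vector `Y` for which `B *ᵥ Y` is standard Gaussian. -/
noncomputable def whitenedGaussianPDF (B : Matrix ι ι ℝ) (y : ι → ℝ) : ℝ :=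
  |B.det| * ∏ i, gaussianPDFReal 0 1 ((B *ᵥ y) i)

theorem map_inv_mulVec_volume {M : Matrix ι ι ℝ} (hM : M.det ≠ 0) :
    (volume : Measure (ι → ℝ)).map (fun w => M⁻¹ *ᵥ w) = ENNReal.ofReal |M.det| • volume := by
  have h := Real.map_matrix_volume_pi_eq_smul_volume_pi (M := M⁻¹)
    (by simpa [Matrix.det_nonsing_inv] using hM)
  rwa [Matrix.det_nonsing_inv, Ring.inverse_eq_inv', inv_inv] at h

@[fun_prop]
theorem measurable_whitenedGaussianPDF : Measurable (whitenedGaussianPDF B) := by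
  have := measurable_mulVec B
  have := measurable_gaussianPDFReal 0 1
  unfold whitenedGaussianPDF
  fun_prop

theorem whitenedGaussianPDF_pos (hB : B.det ≠ 0) (y : ι → ℝ) : 0 < whitenedGaussianPDF B y :=
  mul_pos (abs_pos.mpr hB) (Finset.prod_pos fun _ _ => gaussianPDFReal_pos _ _ _ one_ne_zero)

theorem log_whitenedGaussianPDF (hB : B.det ≠ 0) (y : ι → ℝ) :
    Real.log (whitenedGaussianPDF B y) =
      Real.log |B.det| - ∑ i, (Real.log (2 * Real.pi) + (B *ᵥ y) i ^ 2) / 2 := by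
  have hlog (w : ℝ) :
      Real.log (gaussianPDFReal 0 1 w) = -((Real.log (2 * Real.pi) + w ^ 2) / 2) := by
    rw [gaussianPDFReal, Real.log_mul (by positivity) (Real.exp_pos _).ne', Real.log_exp,
      Real.log_inv, Real.log_sqrt (by positivity), NNReal.coe_one]
    ring_nf
  have hpos (i : ι) := gaussianPDFReal_pos 0 1 ((B *ᵥ y) i) one_ne_zero
  rw [whitenedGaussianPDF, Real.log_mul (abs_pos.mpr hB).ne'
    (Finset.prod_pos fun i _ => hpos i).ne', Real.log_prod fun i _ => (hpos i).ne']
  simp_rw [hlog, Finset.sum_neg_distrib, sub_eq_add_neg]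

theorem det_ne_zero_of_mul_mul_transpose_eq_one (hB : B * S * Bᵀ = 1) : B.det ≠ 0 := by
  intro h
  simpa [Matrix.det_mul, h] using congrArg Matrix.det hB

theorem log_abs_det_of_mul_mul_transpose_eq_one (hB : B * S * Bᵀ = 1) :
    Real.log |B.det| = -(Real.log S.det / 2) := by
  have hdet : B.det ^ 2 * S.det = 1 := by
    have h := congrArg Matrix.det hB
    rw [Matrix.det_mul, Matrix.det_mul, Matrix.det_one, Matrix.det_transpose] at h
    linarith
  have hlog := congrArg Real.log hdet
  rw [Real.log_mul (left_ne_zero_of_mul_eq_one hdet) (right_ne_zero_of_mul_eq_one hdet),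
    Real.log_pow, Real.log_one, Nat.cast_ofNat] at hlog
  rw [Real.log_abs]
  linarith

namespace HasCenteredGaussianLaw

theorem map_eq_withDensity (hY : HasCenteredGaussianLaw Y S P) (hB : B * S * Bᵀ = 1) :
    P.map (fun ω i => Y i ω) =
      volume.withDensity fun y => ENNReal.ofReal (whitenedGaussianPDF B y) := by
  have hdet : B.det ≠ 0 := det_ne_zero_of_mul_mul_transpose_eq_one hB
  let φ : (ι → ℝ) → ℝ := fun w => ∏ i, gaussianPDFReal 0 1 (w i)
  have hφ : Measurable fun y => ENNReal.ofReal (φ (B *ᵥ y)) := by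
    have := measurable_gaussianPDFReal 0 1
    have := measurable_mulVec B
    fun_prop
  have hinv (w : ι → ℝ) : B *ᵥ (B⁻¹ *ᵥ w) = w := by
    rw [Matrix.mulVec_mulVec, Matrix.mul_nonsing_inv _ hdet.isUnit, Matrix.one_mulVec]
  have hstd : P.map (fun ω => B *ᵥ fun i => Y i ω) =
      volume.withDensity fun w => ENNReal.ofReal (φ w) := by
    have hW := hY.mulVec B
    rw [hB] at hW
    rw [hW.map_eq_pi, gaussianReal_of_var_ne_zero 0 one_ne_zero]
    exact pi_withDensity (fun _ => gaussianPDFReal_nonneg 0 1)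
      fun _ => integrable_gaussianPDFReal 0 1
  calc P.map (fun ω i => Y i ω)
      = (P.map fun ω => B *ᵥ fun i => Y i ω).map fun w => B⁻¹ *ᵥ w := by
        have hBY : AEMeasurable (fun ω => B *ᵥ fun i => Y i ω) P :=
          (measurable_mulVec B).comp_aemeasurable hY.gaussian.aemeasurable
        rw [AEMeasurable.map_map_of_aemeasurable (measurable_mulVec _).aemeasurable hBY]
        simp [Function.comp_def, Matrix.nonsing_inv_mul _ hdet.isUnit]
    _ = (volume.withDensity fun w => ENNReal.ofReal (φ (B *ᵥ (B⁻¹ *ᵥ w)))).map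
          fun w => B⁻¹ *ᵥ w := by simp_rw [hstd, hinv]
    _ = volume.withDensity fun y => ENNReal.ofReal (whitenedGaussianPDF B y) := by
        rw [map_withDensity_comp (measurable_mulVec _) hφ, map_inv_mulVec_volume hdet,
          withDensity_smul_measure, ← withDensity_smul _ hφ]
        congr 1 with y
        rw [whitenedGaussianPDF, ENNReal.ofReal_mul (abs_nonneg _), Pi.smul_apply, smul_eq_mul]

theorem integrable_log_pdf (hY : HasCenteredGaussianLaw Y S P) (hB : B * S * Bᵀ = 1) :
    Integrable (fun ω => Real.log (whitenedGaussianPDF B fun i => Y i ω)) P := by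
  have := hY.gaussian.isProbabilityMeasure
  simp_rw [log_whitenedGaussianPDF (det_ne_zero_of_mul_mul_transpose_eq_one hB)]
  exact (integrable_const _).sub (integrable_finsetSum _ fun i _ =>
    ((integrable_const _).add ((hY.mulVec B).memLp_two i).integrable_sq).div_const 2)

theorem integral_log_pdf (hY : HasCenteredGaussianLaw Y S P) (hB : B * S * Bᵀ = 1) :
    ∫ ω, Real.log (whitenedGaussianPDF B fun i => Y i ω) ∂P =
      -((Real.log S.det + Fintype.card ι * (Real.log (2 * Real.pi) + 1)) / 2) := by
  have := hY.gaussian.isProbabilityMeasure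
  have hW := hY.mulVec B
  rw [hB] at hW
  have hsq (i : ι) : Integrable (fun ω => (B *ᵥ fun j => Y j ω) i ^ 2) P :=
    (hW.memLp_two i).integrable_sq
  have hterm (i : ι) :
      Integrable (fun ω => (Real.log (2 * Real.pi) + (B *ᵥ fun j => Y j ω) i ^ 2) / 2) P :=
    ((integrable_const _).add (hsq i)).div_const 2
  have hval (i : ι) : ∫ ω, (Real.log (2 * Real.pi) + (B *ᵥ fun j => Y j ω) i ^ 2) / 2 ∂P =
      (Real.log (2 * Real.pi) + 1) / 2 := by
    rw [integral_div, integral_add (integrable_const _) (hsq i), hW.integral_sq]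
    simp
  simp_rw [log_whitenedGaussianPDF (det_ne_zero_of_mul_mul_transpose_eq_one hB)]
  rw [integral_sub (integrable_const _) (integrable_finsetSum _ fun i _ => hterm i),
    integral_finsetSum _ fun i _ => hterm i, log_abs_det_of_mul_mul_transpose_eq_one hB]
  simp only [hval, integral_const, probReal_univ, Finset.sum_const, Finset.card_univ, nsmul_eq_mul,
    smul_eq_mul]
  ring

theorem mutualInfo_add {F e : ι → Ω → ℝ} {K : Matrix ι ι ℝ} (hF : HasCenteredGaussianLaw F K P)
    (he : HasCenteredGaussianLaw e S P) (hS : S.PosDef)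
    (hFe : IndepFun (fun ω i => F i ω) (fun ω i => e i ω) P)
    (hFm : ∀ i, Measurable (F i)) (hem : ∀ i, Measurable (e i)) :
    mutualInfo P (fun ω i => F i ω + e i ω) (fun ω i => F i ω) =
      ENNReal.ofReal ((Real.log (K + S).det - Real.log S.det) / 2) := by
  have := hF.gaussian.isProbabilityMeasure
  have hY := hF.add_of_indepFun he hFe
  obtain ⟨B, hB⟩ := exists_mul_mul_transpose_eq_one (hS.posSemidef_add hF.posSemidef)
  obtain ⟨C, hC⟩ := exists_mul_mul_transpose_eq_one hS
  refine (mutualInfo_add_self_right (ν := volume) (measurable_pi_lambda _ hFm)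
    (measurable_pi_lambda _ hem) hFe measurable_whitenedGaussianPDF
    (whitenedGaussianPDF_pos (det_ne_zero_of_mul_mul_transpose_eq_one hB))
    measurable_whitenedGaussianPDF
    (whitenedGaussianPDF_pos (det_ne_zero_of_mul_mul_transpose_eq_one hC))
    (hY.map_eq_withDensity hB) (he.map_eq_withDensity hC) (hY.integrable_log_pdf hB)
    (he.integrable_log_pdf hC)).trans ?_
  congr 1
  refine (congrArg₂ (· - ·) (he.integral_log_pdf hC) (hY.integral_log_pdf hB)).trans ?_
  ring

end HasCenteredGaussianLaw

end Whitening

end CenteredGaussian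

section GaussianTail

theorem gaussianReal_Ioi_zero_le (v : ℝ≥0) : gaussianReal 0 v (Set.Ioi 0) ≤ 1 / 2 := by
  have hsymm : gaussianReal 0 v (Set.Iio 0) = gaussianReal 0 v (Set.Ioi 0) := by
    conv_rhs => rw [← neg_zero, ← gaussianReal_map_neg,
      Measure.map_apply measurable_neg measurableSet_Ioi]
    simp
  have hdisj : Disjoint (Set.Ioi (0 : ℝ)) (Set.Iio 0) :=
    Set.disjoint_left.2 fun _ h₁ h₂ => lt_asymm (Set.mem_Ioi.1 h₁) h₂
  rw [ENNReal.le_div_iff_mul_le (by simp) (by simp), mul_two]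
  nth_rw 2 [← hsymm]
  rw [← measure_union hdisj measurableSet_Iio]
  exact prob_le_one

theorem gaussianReal_Ioi_le (v : ℝ≥0) {c : ℝ} (hc : 0 ≤ c) :
    gaussianReal 0 v (Set.Ioi c) ≤ ENNReal.ofReal (Real.exp (-c ^ 2 / (2 * v)) / 2) := by
  rcases eq_or_ne v 0 with rfl | hv
  · simp [gaussianReal_zero_var, hc.not_gt]
  have hshift : gaussianReal 0 v (Set.Ioi c) = gaussianReal (-c) v (Set.Ioi 0) := by
    rw [← zero_sub, ← gaussianReal_map_sub_const, Measure.map_apply (by fun_prop) measurableSet_Ioi]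
    simp
  have hpdf : ∀ x ∈ Set.Ioi (0 : ℝ), gaussianPDF (-c) v x ≤
      ENNReal.ofReal (Real.exp (-c ^ 2 / (2 * v))) * gaussianPDF 0 v x := by
    intro x hx
    rw [gaussianPDF, gaussianPDF, ← ENNReal.ofReal_mul (Real.exp_pos _).le, gaussianPDFReal,
      gaussianPDFReal, mul_left_comm, ← Real.exp_add, ← add_div]
    gcongr
    nlinarith [mul_nonneg (Set.mem_Ioi.1 hx).le hc]
  calc gaussianReal 0 v (Set.Ioi c)
      = ∫⁻ x in Set.Ioi 0, gaussianPDF (-c) v x := by rw [hshift, gaussianReal_apply _ hv]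
    _ ≤ ∫⁻ x in Set.Ioi 0, ENNReal.ofReal (Real.exp (-c ^ 2 / (2 * v))) * gaussianPDF 0 v x :=
        setLIntegral_mono' measurableSet_Ioi hpdf
    _ = ENNReal.ofReal (Real.exp (-c ^ 2 / (2 * v))) * gaussianReal 0 v (Set.Ioi 0) := by
        rw [lintegral_const_mul _ (measurable_gaussianPDF 0 v), gaussianReal_apply _ hv]
    _ ≤ ENNReal.ofReal (Real.exp (-c ^ 2 / (2 * v))) * (1 / 2) := by
        gcongr
        exact gaussianReal_Ioi_zero_le v
    _ = ENNReal.ofReal (Real.exp (-c ^ 2 / (2 * v)) / 2) := by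
        rw [ENNReal.ofReal_div_of_pos two_pos, ENNReal.ofReal_ofNat, mul_one_div]

theorem gaussianReal_Ioi_sqrt_le (v : ℝ≥0) {z : ℝ} (hz : 0 ≤ z) :
    gaussianReal 0 v (Set.Ioi (√z * √v)) ≤ ENNReal.ofReal (Real.exp (-z / 2) / 2) := by
  rcases eq_or_ne v 0 with rfl | hv
  · simp
  refine (gaussianReal_Ioi_le v (by positivity)).trans_eq ?_
  rw [mul_pow, Real.sq_sqrt hz, Real.sq_sqrt v.coe_nonneg]
  congr 3
  field_simp

end GaussianTail

section ShiftedExponential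

variable {r : ℝ}

theorem expMeasure_Ioi (hr : 0 < r) {t : ℝ} (ht : 0 ≤ t) :
    expMeasure r (Set.Ioi t) = ENNReal.ofReal (Real.exp (-(r * t))) := by
  have := isProbabilityMeasure_expMeasure hr
  rw [← ofReal_measureReal, ← Set.compl_Iic, probReal_compl_eq_one_sub measurableSet_Iic,
    ← cdf_eq_real, cdf_expMeasure_eq hr, if_pos ht, sub_sub_cancel]

theorem ae_pos_expMeasure (hr : 0 < r) : ∀ᵐ x ∂expMeasure r, 0 < x := by
  have := isProbabilityMeasure_expMeasure hr
  refine (prob_compl_eq_zero_iff measurableSet_Ioi).2 ?_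
  rw [expMeasure_Ioi hr le_rfl, mul_zero, neg_zero, Real.exp_zero, ENNReal.ofReal_one]

theorem lintegral_id_expMeasure (hr : 0 < r) :
    ∫⁻ x, ENNReal.ofReal x ∂expMeasure r = ENNReal.ofReal r⁻¹ := by
  have hpos : 0 ≤ᵐ[expMeasure r] fun x : ℝ => x := (ae_pos_expMeasure hr).mono fun x hx => hx.le
  calc ∫⁻ x, ENNReal.ofReal x ∂expMeasure r
      = ∫⁻ t in Set.Ioi (0 : ℝ), expMeasure r (Set.Ioi t) :=
        lintegral_eq_lintegral_meas_lt _ hpos aemeasurable_id'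
    _ = ∫⁻ t in Set.Ioi (0 : ℝ), ENNReal.ofReal (Real.exp (-r * t)) :=
        setLIntegral_congr_fun measurableSet_Ioi fun t ht => by
          rw [expMeasure_Ioi hr (Set.mem_Ioi.1 ht).le, neg_mul]
    _ = ENNReal.ofReal (∫ t in Set.Ioi (0 : ℝ), Real.exp (-r * t)) :=
        (ofReal_integral_eq_lintegral_ofReal (integrableOn_exp_mul_Ioi (neg_neg_of_pos hr) 0)
          (.of_forall fun _ => (Real.exp_pos _).le)).symm
    _ = ENNReal.ofReal r⁻¹ := by
        rw [integral_exp_mul_Ioi (neg_neg_of_pos hr)]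
        simp

theorem integrable_id_expMeasure (hr : 0 < r) : Integrable (fun x : ℝ => x) (expMeasure r) := by
  refine ⟨by fun_prop, ?_⟩
  rw [hasFiniteIntegral_iff_ofReal ((ae_pos_expMeasure hr).mono fun x hx => hx.le),
    lintegral_id_expMeasure hr]
  exact ENNReal.ofReal_lt_top

theorem integral_id_expMeasure (hr : 0 < r) : ∫ x, x ∂expMeasure r = r⁻¹ := by
  rw [integral_eq_lintegral_of_nonneg_ae ((ae_pos_expMeasure hr).mono fun x hx => hx.le)
    (by fun_prop), lintegral_id_expMeasure hr, ENNReal.toReal_ofReal (inv_pos.2 hr).le]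

variable (s : ℝ)

theorem isProbabilityMeasure_twoParamExp (hr : 0 < r) : IsProbabilityMeasure (twoParamExp s r) :=
  have := isProbabilityMeasure_expMeasure hr
  Measure.isProbabilityMeasure_map (by fun_prop)

theorem integrable_id_twoParamExp (hr : 0 < r) :
    Integrable (fun x : ℝ => x) (twoParamExp s r) := by
  have := isProbabilityMeasure_expMeasure hr
  rw [twoParamExp, integrable_map_measure (by fun_prop) (by fun_prop)]
  exact (integrable_const s).add (integrable_id_expMeasure hr)

theorem integral_id_twoParamExp (hr : 0 < r) : ∫ x, x ∂twoParamExp s r = s + r⁻¹ := by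
  have := isProbabilityMeasure_expMeasure hr
  rw [twoParamExp, integral_map (by fun_prop) (by fun_prop),
    integral_add (integrable_const s) (integrable_id_expMeasure hr), integral_id_expMeasure hr]
  simp

theorem ae_lt_twoParamExp (hr : 0 < r) : ∀ᵐ z ∂twoParamExp s r, s < z := by
  rw [twoParamExp, ae_map_iff (by fun_prop) measurableSet_Ioi]
  filter_upwards [ae_pos_expMeasure hr] with x hx
  exact lt_add_of_pos_right s hx

theorem twoParamExp_Ioi (hr : 0 < r) {z : ℝ} (hz : s ≤ z) :
    twoParamExp s r (Set.Ioi z) = ENNReal.ofReal (Real.exp (-(r * (z - s)))) := by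
  rw [twoParamExp, Measure.map_apply (by fun_prop) measurableSet_Ioi,
    Set.preimage_const_add_Ioi, expMeasure_Ioi hr (sub_nonneg.2 hz)]

theorem memLp_sqrt_twoParamExp (hr : 0 < r) : MemLp (fun z : ℝ => √z) 2 (twoParamExp s r) := by
  rw [memLp_two_iff_integrable_sq (by fun_prop)]
  refine (integrable_id_twoParamExp s hr).pos_part.congr (.of_forall fun z => ?_)
  change max z 0 = √z ^ 2
  rcases le_total 0 z with hz | hz
  · rw [Real.sq_sqrt hz, max_eq_left hz]
  · rw [Real.sqrt_eq_zero_of_nonpos hz, max_eq_right hz, zero_pow two_ne_zero]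

end ShiftedExponential

section FiniteSup

variable {ι : Type*} [Finite ι] [Nonempty ι]

theorem integrable_iSup_of_finite {Ω : Type*} [MeasurableSpace Ω] {P : Measure Ω} {g : ι → Ω → ℝ}
    (hg : ∀ i, Integrable (g i) P) : Integrable (fun ω => ⨆ i, g i ω) P := by
  have := Fintype.ofFinite ι
  refine (integrable_finsetSum Finset.univ fun i _ => (hg i).abs).mono'
    (AEMeasurable.iSup fun i => (hg i).aemeasurable).aestronglyMeasurable (.of_forall fun ω => ?_)
  obtain ⟨i, hi⟩ := exists_eq_ciSup_of_finite (f := fun i => g i ω)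
  rw [← hi, Real.norm_eq_abs]
  exact Finset.single_le_sum (f := fun i => |g i ω|) (fun _ _ => abs_nonneg _) (Finset.mem_univ i)

theorem continuous_iSup_of_finite {α : Type*} [TopologicalSpace α] {g : ι → α → ℝ}
    (hg : ∀ i, Continuous (g i)) : Continuous fun z => ⨆ i, g i z := by
  have := Fintype.ofFinite ι
  simp_rw [← Finset.sup'_univ_eq_ciSup]
  exact Continuous.finset_sup'_apply _ fun i _ => hg i

end FiniteSup

section Domination

variable {Ω : Type*} [MeasurableSpace Ω] {P : Measure Ω}

theorem integral_le_of_measure_lt_le {Ω' : Type*} [MeasurableSpace Ω'] {Q : Measure Ω'}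
    [IsProbabilityMeasure P] [IsProbabilityMeasure Q] {M : Ω → ℝ} {H : Ω' → ℝ}
    (hM : Integrable M P) (hH : Integrable H Q) (b : ℝ) (hb : ∀ᵐ z ∂Q, b ≤ H z)
    (h : ∀ c, b ≤ c → P {ω | c < M ω} ≤ Q {z | c ≤ H z}) :
    ∫ ω, M ω ∂P ≤ ∫ z, H z ∂Q := by
  have hM' : Integrable (fun ω => max (M ω - b) 0) P := (hM.sub (integrable_const b)).pos_part
  have hH' : Integrable (fun z => H z - b) Q := hH.sub (integrable_const b)
  have hM₀ : 0 ≤ᵐ[P] fun ω => max (M ω - b) 0 := .of_forall fun ω => le_max_right _ _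
  have hH₀ : 0 ≤ᵐ[Q] fun z => H z - b := hb.mono fun z hz => sub_nonneg.2 hz
  have htail : ∫⁻ ω, ENNReal.ofReal (max (M ω - b) 0) ∂P ≤ ∫⁻ z, ENNReal.ofReal (H z - b) ∂Q := by
    rw [lintegral_eq_lintegral_meas_lt _ hM₀ hM'.1.aemeasurable,
      lintegral_eq_lintegral_meas_le _ hH₀ hH'.1.aemeasurable]
    refine setLIntegral_mono' measurableSet_Ioi fun u hu => ?_
    have hu₀ : 0 < u := hu
    simpa only [lt_max_iff, hu₀.not_gt, or_false, lt_sub_iff_add_lt', le_sub_iff_add_le']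
      using h (b + u) (by linarith)
  have hexcess : ∫ ω, (M ω - b) ∂P ≤ ∫ z, (H z - b) ∂Q := by
    refine (integral_mono (hM.sub (integrable_const b)) hM' fun ω => le_max_left _ _).trans ?_
    rw [integral_eq_lintegral_of_nonneg_ae hM₀ hM'.1, integral_eq_lintegral_of_nonneg_ae hH₀ hH'.1]
    exact ENNReal.toReal_mono ((hasFiniteIntegral_iff_ofReal hH₀).1 hH'.2).ne htail
  rw [integral_sub hM (integrable_const b), integral_sub hH (integrable_const b)] at hexcess
  simpa using hexcess

theorem measure_lt_le_measure_le_of_monotone {Q : Measure ℝ} [IsFiniteMeasure Q] {M : Ω → ℝ}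
    {h : ℝ → ℝ} (hmono : Monotone h) (hcont : Continuous h) {s : ℝ}
    (htail : ∀ z, s ≤ z → P {ω | h z < M ω} ≤ Q (Set.Ioi z)) {c : ℝ} (hc : h s ≤ c) :
    P {ω | c < M ω} ≤ Q {z | c ≤ h z} := by
  by_cases hex : ∃ z, s ≤ z ∧ c ≤ h z
  · obtain ⟨z₁, hsz₁, hcz₁⟩ := hex
    obtain ⟨z, ⟨hsz, -⟩, rfl⟩ := intermediate_value_Icc hsz₁ hcont.continuousOn ⟨hc, hcz₁⟩
    exact (htail z hsz).trans (measure_mono fun y hy => hmono (Set.mem_Ioi.1 hy).le)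
  · push Not at hex
    have hle : ∀ z, s ≤ z → P {ω | c < M ω} ≤ Q (Set.Ioi z) := fun z hz =>
      (measure_mono fun ω hω => (hex z hz).trans hω).trans (htail z hz)
    have hlim : Filter.Tendsto (fun z => Q (Set.Ioi z)) Filter.atTop (nhds 0) := by
      have := tendsto_measure_iInter_atTop (μ := Q) (s := fun z : ℝ => Set.Ioi z)
        (fun z => measurableSet_Ioi.nullMeasurableSet) (fun z y h => Set.Ioi_subset_Ioi h)
        ⟨0, measure_ne_top _ _⟩
      rwa [show ⋂ z : ℝ, Set.Ioi z = ∅ from Set.iInter_eq_empty_iff.2 fun z => ⟨z, by simp⟩,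
        measure_empty] at this
    exact (ge_of_tendsto hlim (Filter.eventually_atTop.2 ⟨s, hle⟩)).trans zero_le

variable {X : Type*} [Nonempty X] {s r : ℝ} (m : X → ℝ) (v : X → ℝ≥0) {R : X → Ω → ℝ}

theorem integrable_iSup_ucb_twoParamExp [Finite X] (hr : 0 < r) :
    Integrable (fun z => ⨆ x, (m x + √z * √(v x))) (twoParamExp s r) := by
  have := isProbabilityMeasure_twoParamExp s hr
  exact integrable_iSup_of_finite fun x => (integrable_const _).add
    (((memLp_sqrt_twoParamExp s hr).integrable one_le_two).mul_const _)

variable [Fintype X]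

theorem measure_iSup_ucb_lt_iSup_le (hR : ∀ x, HasLaw (R x) (gaussianReal 0 (v x)) P)
    (hs₀ : 0 ≤ s) (hs : 2 * Real.log (Fintype.card X / 2) ≤ s) (hr : 0 < r) (hr' : r ≤ 1 / 2)
    {z : ℝ} (hz : s ≤ z) :
    P {ω | ⨆ x, (m x + √z * √(v x)) < ⨆ x, (m x + R x ω)} ≤ twoParamExp s r (Set.Ioi z) := by
  have hsub : {ω | ⨆ x, (m x + √z * √(v x)) < ⨆ x, (m x + R x ω)} ⊆
      ⋃ x, R x ⁻¹' Set.Ioi (√z * √(v x)) := by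
    intro ω hω
    obtain ⟨x, hx⟩ := exists_lt_of_lt_ciSup (Set.mem_ofPred_eq ▸ hω)
    have hle := Finite.le_ciSup (fun x => m x + √z * √(v x)) x
    have hRx : √z * √(v x) < R x ω := by linarith
    exact Set.mem_iUnion.2 ⟨x, hRx⟩
  have hcard : (0 : ℝ) < Fintype.card X / 2 := by
    have := Fintype.card_pos (α := X)
    positivity
  calc P {ω | ⨆ x, (m x + √z * √(v x)) < ⨆ x, (m x + R x ω)}
      ≤ ∑ x, P (R x ⁻¹' Set.Ioi (√z * √(v x))) :=
        (measure_mono hsub).trans (measure_iUnion_fintype_le _ _)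
    _ ≤ ∑ _x : X, ENNReal.ofReal (Real.exp (-z / 2) / 2) := by
        refine Finset.sum_le_sum fun x _ => ?_
        rw [← Measure.map_apply_of_aemeasurable (hR x).aemeasurable measurableSet_Ioi,
          (hR x).map_eq]
        exact gaussianReal_Ioi_sqrt_le (v x) (hs₀.trans hz)
    _ = ENNReal.ofReal (Real.exp (Real.log (Fintype.card X / 2) - z / 2)) := by
        rw [Finset.sum_const, Finset.card_univ, nsmul_eq_mul, ← ENNReal.ofReal_natCast,
          ← ENNReal.ofReal_mul (by positivity), sub_eq_add_neg, Real.exp_add, Real.exp_log hcard]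
        ring_nf
    _ ≤ ENNReal.ofReal (Real.exp (-(r * (z - s)))) := by
        gcongr
        nlinarith
    _ = twoParamExp s r (Set.Ioi z) := (twoParamExp_Ioi s hr hz).symm

theorem integral_iSup_le_integral_iSup_ucb [IsProbabilityMeasure P]
    (hR : ∀ x, HasLaw (R x) (gaussianReal 0 (v x)) P) (hs₀ : 0 ≤ s)
    (hs : 2 * Real.log (Fintype.card X / 2) ≤ s) (hr : 0 < r) (hr' : r ≤ 1 / 2) :
    ∫ ω, ⨆ x, (m x + R x ω) ∂P ≤ ∫ z, ⨆ x, (m x + √z * √(v x)) ∂twoParamExp s r := by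
  have := isProbabilityMeasure_twoParamExp s hr
  have hmono : Monotone fun z : ℝ => ⨆ x, (m x + √z * √(v x)) := fun z z' hz =>
    Finite.ciSup_mono fun x => by gcongr
  have hcont : Continuous fun z : ℝ => ⨆ x, (m x + √z * √(v x)) :=
    continuous_iSup_of_finite fun x => by fun_prop
  have hint : Integrable (fun ω => ⨆ x, (m x + R x ω)) P :=
    integrable_iSup_of_finite fun x => (integrable_const _).add (hR x).hasGaussianLaw.integrable
  exact integral_le_of_measure_lt_le hint (integrable_iSup_ucb_twoParamExp m v hr) _
    ((ae_lt_twoParamExp s hr).mono fun z hz => hmono hz.le) fun c hc =>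
      measure_lt_le_measure_le_of_monotone hmono hcont
        (fun z hz => measure_iSup_ucb_lt_iSup_le m v hR hs₀ hs hr hr' hz) hc

end Domination

section Gram

variable {X : Type*} {k : X → X → ℝ} {σ : ℝ} {t : ℕ}

theorem det_eq_det_mul_schur {R : Type*} [CommRing R] {n : ℕ}
    (A : Matrix (Fin (n + 1)) (Fin (n + 1)) R)
    (hA : IsUnit (A.submatrix Fin.castSucc Fin.castSucc).det) :
    A.det = (A.submatrix Fin.castSucc Fin.castSucc).det * (A (Fin.last n) (Fin.last n) -
      (fun i => A (Fin.last n) (Fin.castSucc i)) ⬝ᵥ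
        ((A.submatrix Fin.castSucc Fin.castSucc)⁻¹ *ᵥ
          fun i => A (Fin.castSucc i) (Fin.last n))) := by
  have := Matrix.invertibleOfIsUnitDet _ hA
  have hblock : A.submatrix finSumFinEquiv finSumFinEquiv = Matrix.fromBlocks
      (A.submatrix Fin.castSucc Fin.castSucc)
      (Matrix.of fun i (_ : Fin 1) => A (Fin.castSucc i) (Fin.last n))
      (Matrix.of fun (_ : Fin 1) i => A (Fin.last n) (Fin.castSucc i))
      (Matrix.of fun (_ _ : Fin 1) => A (Fin.last n) (Fin.last n)) := by
    have hinit (i : Fin n) : Fin.castAdd 1 i = Fin.castSucc i := rfl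
    have hlast (i : Fin 1) : Fin.natAdd n i = Fin.last n := by rw [Subsingleton.elim i 0]; rfl
    ext (i | i) (j | j) <;> simp [hinit, hlast]
  rw [← Matrix.det_submatrix_equiv_self finSumFinEquiv, hblock, Matrix.det_fromBlocks₁₁,
    Matrix.det_fin_one, Matrix.invOf_eq_nonsing_inv, Matrix.mul_assoc]
  rfl

theorem posDef_kernelMatrix_add (hk : (Matrix.of k).PosSemidef) (hσ : σ ≠ 0) (a : Fin t → X) :
    (kernelMatrix k a + σ ^ 2 • (1 : Matrix (Fin t) (Fin t) ℝ)).PosDef :=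
  Matrix.PosDef.posSemidef_add (hk.submatrix a) (Matrix.PosDef.one.smul (by positivity))

theorem posDef_one_add_smul_kernelMatrix (hk : (Matrix.of k).PosSemidef) {c : ℝ} (hc : 0 ≤ c)
    (a : Fin t → X) : (1 + c • kernelMatrix k a).PosDef :=
  Matrix.PosDef.one.add_posSemidef ((hk.submatrix a).smul hc)

theorem det_kernelMatrix_add (hσ : σ ≠ 0) (a : Fin t → X) :
    (kernelMatrix k a + σ ^ 2 • (1 : Matrix (Fin t) (Fin t) ℝ)).det =
      (σ ^ 2) ^ t * (1 + (σ ^ 2)⁻¹ • kernelMatrix k a).det := by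
  have h := Matrix.det_smul (1 + (σ ^ 2)⁻¹ • kernelMatrix k a) (σ ^ 2)
  rwa [smul_add, smul_inv_smul₀ (pow_ne_zero 2 hσ), add_comm, Fintype.card_fin] at h

theorem postVar_le (hk : (Matrix.of k).PosSemidef) (hσ : σ ≠ 0) (a : Fin t → X) (x : X) :
    postVar k σ a x ≤ k x x :=
  sub_le_self _ <| by
    simpa only [star_trivial] using
      (posDef_kernelMatrix_add hk hσ a).inv.posSemidef.dotProduct_mulVec_nonneg (kernelVec k a x)

theorem postVar_nonneg (hk : (Matrix.of k).PosSemidef) (hσ : σ ≠ 0) (a : Fin t → X) (x : X) :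
    0 ≤ postVar k σ a x := by
  set S := kernelMatrix k a + σ ^ 2 • (1 : Matrix (Fin t) (Fin t) ℝ)
  let C : Matrix (Fin t) Unit ℝ := Matrix.of fun i _ => k x (a i)
  have hS : S.PosDef := posDef_kernelMatrix_add hk hσ a
  have := hS.isUnit.invertible
  have hblock : (Matrix.fromBlocks S C Cᴴ (Matrix.of fun _ _ => k x x)).PosSemidef := by
    have hnoise :
        (Matrix.diagonal (Sum.elim (fun _ : Fin t => σ ^ 2) fun _ : Unit => 0)).PosSemidef :=
      .diagonal (Sum.rec (fun _ => sq_nonneg σ) fun _ => le_rfl)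
    convert (hk.submatrix (Sum.elim a fun _ => x)).add hnoise using 1
    ext (i | i) (j | j)
    · simp [S, kernelMatrix, Matrix.diagonal_apply, Matrix.one_apply]
    · simpa [C] using hk.isHermitian.apply (a i) x
    · simp [C]
    · simp
  have hdiag := ((Matrix.PosDef.fromBlocks₁₁ C _ hS).1 hblock).diag_nonneg (i := ())
  rwa [Matrix.mul_assoc] at hdiag

theorem det_one_add_smul_kernelMatrix_succ (hk : (Matrix.of k).PosSemidef) (hσ : σ ≠ 0)
    (a : Fin (t + 1) → X) :
    (1 + (σ ^ 2)⁻¹ • kernelMatrix k a).det =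
      (1 + (σ ^ 2)⁻¹ • kernelMatrix k (a ∘ Fin.castSucc)).det *
        (1 + (σ ^ 2)⁻¹ * postVar k σ (a ∘ Fin.castSucc) (a (Fin.last t))) := by
  have hsub : (kernelMatrix k a + σ ^ 2 • (1 : Matrix (Fin (t + 1)) (Fin (t + 1)) ℝ)).submatrix
      Fin.castSucc Fin.castSucc = kernelMatrix k (a ∘ Fin.castSucc) + σ ^ 2 • 1 := by
    ext i j
    simp [kernelMatrix, Matrix.one_apply]
  have hschur := det_eq_det_mul_schur
    (kernelMatrix k a + σ ^ 2 • (1 : Matrix (Fin (t + 1)) (Fin (t + 1)) ℝ))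
    (hsub ▸ (posDef_kernelMatrix_add hk hσ _).det_pos.ne'.isUnit)
  have hsymm (i : Fin t) : k (a (Fin.castSucc i)) (a (Fin.last t)) =
      kernelVec k (a ∘ Fin.castSucc) (a (Fin.last t)) i :=
    hk.isHermitian.apply (a (Fin.last t)) (a (Fin.castSucc i))
  have hvec : (fun i : Fin t => k (a (Fin.last t)) (a (Fin.castSucc i))) =
      kernelVec k (a ∘ Fin.castSucc) (a (Fin.last t)) := rfl
  have hpost : (kernelMatrix k a + σ ^ 2 • (1 : Matrix (Fin (t + 1)) (Fin (t + 1)) ℝ)).det =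
      (kernelMatrix k (a ∘ Fin.castSucc) + σ ^ 2 • (1 : Matrix (Fin t) (Fin t) ℝ)).det *
        (postVar k σ (a ∘ Fin.castSucc) (a (Fin.last t)) + σ ^ 2) := by
    rw [hschur, hsub, postVar, sub_add_eq_add_sub]
    simp [kernelMatrix, hsymm, hvec, Fin.castSucc_ne_last, (Fin.castSucc_ne_last _).symm]
  rw [det_kernelMatrix_add hσ, det_kernelMatrix_add hσ] at hpost
  refine mul_left_cancel₀ (pow_ne_zero (t + 1) (pow_ne_zero 2 hσ)) (hpost.trans ?_)
  field_simp
  ring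

theorem det_one_add_smul_kernelMatrix_eq_prod (hk : (Matrix.of k).PosSemidef) (hσ : σ ≠ 0)
    (a : ℕ → X) (T : ℕ) :
    (1 + (σ ^ 2)⁻¹ • kernelMatrix k fun i : Fin T => a i).det =
      ∏ t ∈ Finset.range T, (1 + (σ ^ 2)⁻¹ * postVar k σ (fun i : Fin t => a i) (a t)) := by
  induction T with
  | zero => simp
  | succ T ih =>
    rw [det_one_add_smul_kernelMatrix_succ hk hσ, Finset.prod_range_succ, ← ih]
    rfl

theorem mul_log_one_add_le_log_one_add_mul {c u : ℝ} (hc : 0 < c) (hu₀ : 0 ≤ u) (hu₁ : u ≤ 1) :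
    u * Real.log (1 + c) ≤ Real.log (1 + c * u) := by
  have h := strictConcaveOn_log_Ioi.concaveOn.2 (Set.mem_Ioi.2 one_pos)
    (Set.mem_Ioi.2 (by linarith : 0 < 1 + c)) (sub_nonneg.2 hu₁) hu₀ (by ring)
  simp only [smul_eq_mul, Real.log_one, mul_zero, zero_add] at h
  exact h.trans_eq (by ring_nf)

/-- The mutual information between the values of the process at `a₀, …, a_{t-1}` and their noisy
observations, in closed form. -/
noncomputable def infoGain (k : X → X → ℝ) (σ : ℝ) (a : Fin t → X) : ℝ :=
  Real.log (1 + (σ ^ 2)⁻¹ • kernelMatrix k a).det / 2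

theorem sum_postVar_le (hk : (Matrix.of k).PosSemidef) (hk₁ : ∀ x, k x x ≤ 1) (hσ : σ ≠ 0)
    (a : ℕ → X) (T : ℕ) :
    ∑ t ∈ Finset.range T, postVar k σ (fun i : Fin t => a i) (a t) ≤
      2 / Real.log (1 + (σ ^ 2)⁻¹) * infoGain k σ fun i : Fin T => a i := by
  have hc : 0 < (σ ^ 2)⁻¹ := by positivity
  have hlog : 0 < Real.log (1 + (σ ^ 2)⁻¹) := Real.log_pos (by linarith)
  have hv₀ (t : ℕ) := postVar_nonneg hk hσ (fun i : Fin t => a i) (a t)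
  have hv₁ (t : ℕ) := (postVar_le hk hσ (fun i : Fin t => a i) (a t)).trans (hk₁ _)
  rw [infoGain, div_mul_div_comm, mul_comm (Real.log _) 2,
    mul_div_mul_left _ _ two_ne_zero, le_div_iff₀ hlog, Finset.sum_mul,
    det_one_add_smul_kernelMatrix_eq_prod hk hσ,
    Real.log_prod fun t _ => by have := hv₀ t; positivity]
  exact Finset.sum_le_sum fun t _ => mul_log_one_add_le_log_one_add_mul hc (hv₀ t) (hv₁ t)

theorem det_one_add_smul_kernelMatrix_eq_det_card [Fintype X] [DecidableEq X] (c : ℝ)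
    (a : Fin t → X) :
    (1 + c • kernelMatrix k a).det =
      (1 + Matrix.of fun x y => c * k x y * (Finset.univ.filter fun i => a i = y).card).det := by
  let B : Matrix (Fin t) X ℝ := Matrix.of fun i x => if a i = x then 1 else 0
  let C : Matrix X (Fin t) ℝ := Matrix.of fun x i => c * k x (a i)
  have hBC : c • kernelMatrix k a = B * C := by
    ext i j
    simp [kernelMatrix, B, C, Matrix.mul_apply]
  have hCB : (Matrix.of fun x y => c * k x y * (Finset.univ.filter fun i => a i = y).card) =
      C * B := by
    ext x y
    simp only [B, C, Matrix.mul_apply, Matrix.of_apply, mul_ite, mul_one, mul_zero]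
    rw [← Finset.sum_filter, Finset.sum_congr rfl fun i hi => by rw [(Finset.mem_filter.1 hi).2],
      Finset.sum_const, nsmul_eq_mul, mul_comm]
  rw [hBC, hCB, Matrix.det_one_add_mul_comm]

theorem infoGain_le [Fintype X] (hk : (Matrix.of k).PosSemidef) {M : ℝ}
    (hM : ∀ x y, |k x y| ≤ M) (a : Fin t → X) :
    infoGain k σ a ≤ (Real.log (Nat.factorial (Fintype.card X)) +
      Fintype.card X * Real.log (1 + (σ ^ 2)⁻¹ * M * t)) / 2 := by
  classical
  have hc : 0 ≤ (σ ^ 2)⁻¹ := by positivity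
  have hpos := (posDef_one_add_smul_kernelMatrix hk hc a).det_pos
  rw [infoGain]
  rw [det_one_add_smul_kernelMatrix_eq_det_card] at hpos ⊢
  set A : Matrix X X ℝ := Matrix.of fun x y =>
    (σ ^ 2)⁻¹ * k x y * (Finset.univ.filter fun i => a i = y).card
  have hentry (x y : X) : |(1 + A) x y| ≤ 1 + (σ ^ 2)⁻¹ * M * t := by
    refine (abs_add_le _ _).trans (add_le_add ?_ ?_)
    · rw [Matrix.one_apply]
      split_ifs <;> simp
    · have hM₀ : 0 ≤ M := (abs_nonneg _).trans (hM x y)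
      have hcard := Finset.card_le_univ (Finset.univ.filter fun i => a i = y)
      rw [Fintype.card_fin] at hcard
      change |(σ ^ 2)⁻¹ * k x y * (Finset.univ.filter fun i => a i = y).card| ≤ _
      rw [abs_mul, abs_mul, abs_of_nonneg hc, Nat.abs_cast]
      gcongr
      exact hM x y
  have hdet := Matrix.det_le (abv := AbsoluteValue.abs) hentry
  rw [AbsoluteValue.abs_apply, abs_of_pos hpos, nsmul_eq_mul] at hdet
  have hpow : (1 + (σ ^ 2)⁻¹ * M * t) ^ Fintype.card X ≠ 0 := by
    intro h₀
    rw [h₀, mul_zero] at hdet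
    exact hdet.not_gt hpos
  have hlog := Real.log_le_log hpos hdet
  rw [Real.log_mul (Nat.cast_ne_zero.2 (Nat.factorial_ne_zero _)) hpow, Real.log_pow] at hlog
  linarith

end Gram

theorem tendsto_log_one_add_mul_div {c : ℝ} (hc : 0 < c) :
    Filter.Tendsto (fun n : ℕ => Real.log (1 + c * n) / n) Filter.atTop (nhds 0) := by
  have hlin : Filter.Tendsto (fun n : ℕ => 1 + c * (n : ℝ)) Filter.atTop Filter.atTop :=
    Filter.tendsto_atTop_add_const_left _ 1 (tendsto_natCast_atTop_atTop.const_mul_atTop hc)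
  refine ((Real.tendsto_pow_log_div_mul_add_atTop c⁻¹ (-c⁻¹) 1 (inv_ne_zero hc.ne')).comp
    hlin).congr fun n => ?_
  have hn : c⁻¹ * (1 + c * n) + -c⁻¹ = n := by
    field_simp
    ring
  rw [Function.comp_apply, pow_one, hn]

section InfoGain

variable {Ω X : Type*} [MeasurableSpace Ω] {P : Measure Ω}
  {k : X → X → ℝ} {σ : ℝ} {f : X → Ω → ℝ} {ε : ℕ → Ω → ℝ} {t : ℕ}

namespace IsGPModel

theorem hasCenteredGaussianLaw_comp {ι : Type*} [Finite ι] (h : IsGPModel P k σ f ε) (b : ι → X) :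
    HasCenteredGaussianLaw (fun i => f (b i)) (Matrix.of fun i j => k (b i) (b j)) P where
  gaussian :=
    have := Fintype.ofFinite ι
    ((h.gaussian_f.comp_right b).hasGaussianLaw Finset.univ).map_fun
      (ContinuousLinearMap.pi fun i => ContinuousLinearMap.proj
        (⟨i, Finset.mem_univ i⟩ : {i // i ∈ (Finset.univ : Finset ι)}))
  integral_eq_zero i := h.mean_f (b i)
  covariance_eq i j := h.cov_f (b i) (b j)

theorem hasCenteredGaussianLaw_noise (h : IsGPModel P k σ f ε) (t : ℕ) :
    HasCenteredGaussianLaw (fun i : Fin t => ε i) (σ ^ 2 • (1 : Matrix (Fin t) (Fin t) ℝ)) P := by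
  have hnoise := HasCenteredGaussianLaw.of_iIndepFun (fun i : Fin t => h.law_noise i)
    (h.iIndep_noise.precomp Fin.val_injective)
  rwa [Real.coe_toNNReal _ (sq_nonneg σ)] at hnoise

theorem indepFun_comp {ι : Type*} (h : IsGPModel P k σ f ε) (b : ι → X) (t : ℕ) :
    IndepFun (fun ω i => f (b i) ω) (fun ω (i : Fin t) => ε i ω) P :=
  h.indep_f_noise.comp (φ := fun (g : X → ℝ) i => g (b i))
    (ψ := fun (e : ℕ → ℝ) (i : Fin t) => e i) (by fun_prop) (by fun_prop)

theorem posSemidef [Finite X] (h : IsGPModel P k σ f ε) : (Matrix.of k).PosSemidef :=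
  (h.hasCenteredGaussianLaw_comp id).posSemidef

theorem mutualInfo_eq [Finite X] (h : IsGPModel P k σ f ε) (hσ : σ ≠ 0) (a : Fin t → X) :
    mutualInfo P (fun ω (i : Fin t) => f (a i) ω + ε i ω) (fun ω (i : Fin t) => f (a i) ω) =
      ENNReal.ofReal (infoGain k σ a) := by
  have hdet := (posDef_one_add_smul_kernelMatrix h.posSemidef
    (inv_nonneg.2 (sq_nonneg σ)) a).det_pos
  have hσt : (σ ^ 2) ^ t ≠ 0 := by positivity
  have hinfo := (h.hasCenteredGaussianLaw_comp a).mutualInfo_add (h.hasCenteredGaussianLaw_noise t)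
    (Matrix.PosDef.one.smul (by positivity)) (h.indepFun_comp a t)
    (fun i => h.measurable_f (a i)) fun i => h.measurable_noise i
  rw [hinfo, infoGain, ← kernelMatrix, det_kernelMatrix_add hσ, Matrix.det_smul, Matrix.det_one,
    Fintype.card_fin, mul_one, Real.log_mul hσt hdet.ne', add_sub_cancel_left]

theorem toReal_maxInfoGain [Finite X] (h : IsGPModel P k σ f ε) (hσ : σ ≠ 0) (t : ℕ) :
    (maxInfoGain P f ε t).toReal = ⨆ a : Fin t → X, max (infoGain k σ a) 0 := by
  simp only [maxInfoGain, h.mutualInfo_eq hσ, ENNReal.toReal_iSup fun _ => ENNReal.ofReal_ne_top,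
    ENNReal.toReal_ofReal']

theorem infoGain_le_maxInfoGain [Finite X] (h : IsGPModel P k σ f ε) (hσ : σ ≠ 0)
    (a : Fin t → X) : infoGain k σ a ≤ (maxInfoGain P f ε t).toReal := by
  rw [h.toReal_maxInfoGain hσ]
  exact (le_max_left _ _).trans (Finite.le_ciSup (fun a : Fin t → X => max (infoGain k σ a) 0) a)

theorem maxInfoGain_le [Fintype X] (h : IsGPModel P k σ f ε) (hσ : σ ≠ 0) {M : ℝ}
    (hM : ∀ x y, |k x y| ≤ M) (hM₀ : 0 ≤ M) (t : ℕ) :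
    (maxInfoGain P f ε t).toReal ≤ (Real.log (Nat.factorial (Fintype.card X)) +
      Fintype.card X * Real.log (1 + (σ ^ 2)⁻¹ * M * t)) / 2 := by
  have := Real.log_natCast_nonneg (Nat.factorial (Fintype.card X))
  have hlog : 0 ≤ Real.log (1 + (σ ^ 2)⁻¹ * M * t) :=
    Real.log_nonneg (le_add_of_nonneg_right (by positivity))
  rw [h.toReal_maxInfoGain hσ]
  exact Real.iSup_le (fun a => max_le (infoGain_le h.posSemidef hM a) (by positivity))
    (by positivity)

theorem tendsto_maxInfoGain_div [Finite X] (h : IsGPModel P k σ f ε) (hσ : σ ≠ 0) :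
    Filter.Tendsto (fun n : ℕ => (maxInfoGain P f ε n).toReal / n) Filter.atTop (nhds 0) := by
  have := Fintype.ofFinite X
  obtain ⟨M, hM⟩ := Finite.bddAbove_range fun p : X × X => |k p.1 p.2|
  have hM' (x y : X) : |k x y| ≤ max M 1 := (hM ⟨(x, y), rfl⟩).trans (le_max_left _ _)
  have hc : 0 < (σ ^ 2)⁻¹ * max M 1 := by positivity
  have hlim : Filter.Tendsto (fun n : ℕ => Real.log (Nat.factorial (Fintype.card X)) / 2 / n +
      Fintype.card X / 2 * (Real.log (1 + (σ ^ 2)⁻¹ * max M 1 * n) / n)) Filter.atTop (nhds 0) := by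
    simpa using (tendsto_const_div_atTop_nhds_zero_nat _).add
      ((tendsto_log_one_add_mul_div hc).const_mul ((Fintype.card X : ℝ) / 2))
  refine squeeze_zero (fun n => by positivity) (fun n => ?_) hlim
  calc (maxInfoGain P f ε n).toReal / n
      ≤ (Real.log (Nat.factorial (Fintype.card X)) +
          Fintype.card X * Real.log (1 + (σ ^ 2)⁻¹ * max M 1 * n)) / 2 / n := by
        gcongr
        exact h.maxInfoGain_le hσ hM' (by positivity) n
    _ = _ := by ring

end IsGPModel

end InfoGain

section Regression

variable {Ω ι κ : Type*} [MeasurableSpace Ω] {P : Measure Ω} {F : ι → Ω → ℝ} {Y : κ → Ω → ℝ}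

theorem HasCenteredGaussianLaw.sub_mulVec [Finite ι] [Fintype κ] [DecidableEq κ]
    {A : Matrix ι ι ℝ} {C : Matrix ι κ ℝ} {S : Matrix κ κ ℝ} (hS : S.PosDef)
    (h : HasCenteredGaussianLaw (Sum.elim F Y) (Matrix.fromBlocks A C Cᵀ S) P) :
    HasCenteredGaussianLaw
      (Sum.elim (fun i ω => F i ω - ((C * S⁻¹) *ᵥ fun j => Y j ω) i) Y)
      (Matrix.fromBlocks (A - C * S⁻¹ * Cᵀ) 0 0 S) P := by
  classical
  have := Fintype.ofFinite ι
  have hdet : IsUnit S.det := hS.det_pos.ne'.isUnit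
  have hS' : Sᵀ = S := hS.isHermitian
  let B : Matrix (ι ⊕ κ) (ι ⊕ κ) ℝ := Matrix.fromBlocks 1 (-(C * S⁻¹)) 0 1
  have hcov : B * Matrix.fromBlocks A C Cᵀ S * Bᵀ =
      Matrix.fromBlocks (A - C * S⁻¹ * Cᵀ) 0 0 S := by
    simp [B, Matrix.fromBlocks_transpose, Matrix.fromBlocks_multiply, Matrix.transpose_nonsing_inv,
      hS', Matrix.nonsing_inv_mul_cancel_right _ _ hdet,
      Matrix.mul_nonsing_inv_cancel_left _ _ hdet, sub_eq_add_neg]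
  have hlaw := h.mulVec B
  rw [hcov] at hlaw
  convert hlaw using 1
  ext (i | j) ω <;> simp [B, Matrix.fromBlocks_mulVec, Function.comp_def, sub_eq_add_neg,
    Matrix.neg_mulVec]

theorem HasCenteredGaussianLaw.indepFun_of_fromBlocks [Finite ι] [Finite κ]
    {A : Matrix ι ι ℝ} {S : Matrix κ κ ℝ}
    (h : HasCenteredGaussianLaw (Sum.elim F Y) (Matrix.fromBlocks A 0 0 S) P) :
    IndepFun (fun ω i => F i ω) (fun ω j => Y j ω) P := by
  have := Fintype.ofFinite ι
  have := Fintype.ofFinite κ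
  refine HasGaussianLaw.indepFun_of_covariance_eval (h.gaussian.map_fun
    ((ContinuousLinearMap.pi fun i => ContinuousLinearMap.proj (Sum.inl i)).prod
      (ContinuousLinearMap.pi fun j => ContinuousLinearMap.proj (Sum.inr j)))) fun i j => ?_
  exact h.covariance_eq (Sum.inl i) (Sum.inr j)

end Regression

section Residual

variable {Ω X : Type*} {k : X → X → ℝ} {σ : ℝ} {f : X → Ω → ℝ} {ε : ℕ → Ω → ℝ} {t : ℕ}

/-- The observations at points `a₀, …, a_{t-1}` that are fixed in advance. -/
def fixedObs (f : X → Ω → ℝ) (ε : ℕ → Ω → ℝ) {t : ℕ} (a : Fin t → X) (ω : Ω) (i : Fin t) : ℝ :=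
  f (a i) ω + ε i ω

/-- The error made when `f x` is predicted by its posterior mean given the observations at fixed
points. -/
noncomputable def residual (k : X → X → ℝ) (σ : ℝ) (f : X → Ω → ℝ) (ε : ℕ → Ω → ℝ) {t : ℕ}
    (a : Fin t → X) (x : X) (ω : Ω) : ℝ :=
  f x ω - postMean k σ a (fixedObs f ε a ω) x

@[fun_prop]
theorem continuous_postMean (a : Fin t → X) (x : X) :
    Continuous fun y : Fin t → ℝ => postMean k σ a y x := by
  unfold postMean
  fun_prop

namespace IsGPModel

variable [MeasurableSpace Ω] {P : Measure Ω}

@[fun_prop]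
theorem measurable_fixedObs (h : IsGPModel P k σ f ε) (a : Fin t → X) :
    Measurable (fixedObs f ε a) :=
  measurable_pi_lambda _ fun _ => (h.measurable_f _).add (h.measurable_noise _)

theorem measurable_residual (h : IsGPModel P k σ f ε) (a : Fin t → X) (x : X) :
    Measurable (residual k σ f ε a x) :=
  (h.measurable_f x).sub ((continuous_postMean a x).measurable.comp (h.measurable_fixedObs a))

variable [Finite X]

theorem hasCenteredGaussianLaw_sumElim_fixedObs (h : IsGPModel P k σ f ε) (a : Fin t → X) :
    HasCenteredGaussianLaw (Sum.elim f fun i ω => fixedObs f ε a ω i)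
      (Matrix.fromBlocks (Matrix.of k) (Matrix.of fun x i => k x (a i))
        (Matrix.of fun x i => k x (a i))ᵀ (kernelMatrix k a + σ ^ 2 • 1)) P := by
  have hnoise := (h.hasCenteredGaussianLaw_noise t).mulVec
    (Matrix.fromRows (0 : Matrix X (Fin t) ℝ) (1 : Matrix (Fin t) (Fin t) ℝ))
  have hsum := (h.hasCenteredGaussianLaw_comp (Sum.elim id a)).add_of_indepFun hnoise
    ((h.indepFun_comp (Sum.elim id a) t).comp measurable_id (measurable_mulVec _))
  have hk (i : Fin t) (x : X) : k (a i) x = k x (a i) := h.posSemidef.isHermitian.apply x (a i)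
  convert hsum using 1
  · ext (x | i) ω <;> simp [fixedObs, Matrix.fromRows_mulVec]
  · ext (x | i) (y | j)
    · simp [Matrix.transpose_fromRows]
    · simp [Matrix.transpose_fromRows]
    · simp [Matrix.transpose_fromRows, hk i y]
    · simp [kernelMatrix, Matrix.transpose_fromRows]

theorem hasCenteredGaussianLaw_residual (h : IsGPModel P k σ f ε) (hσ : σ ≠ 0) (a : Fin t → X) :
    HasCenteredGaussianLaw (Sum.elim (residual k σ f ε a) fun i ω => fixedObs f ε a ω i)
      (Matrix.fromBlocks (Matrix.of k - (Matrix.of fun x i => k x (a i)) *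
          (kernelMatrix k a + σ ^ 2 • (1 : Matrix (Fin t) (Fin t) ℝ))⁻¹ *
          (Matrix.of fun x i => k x (a i))ᵀ) 0 0 (kernelMatrix k a + σ ^ 2 • 1)) P := by
  convert (h.hasCenteredGaussianLaw_sumElim_fixedObs a).sub_mulVec
    (posDef_kernelMatrix_add h.posSemidef hσ a) using 3
  ext x
  rw [← Matrix.mulVec_mulVec]
  rfl

theorem hasLaw_residual (h : IsGPModel P k σ f ε) (hσ : σ ≠ 0) (a : Fin t → X) (x : X) :
    HasLaw (residual k σ f ε a x) (gaussianReal 0 (postVar k σ a x).toNNReal) P := by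
  refine ⟨(h.measurable_residual a x).aemeasurable, ?_⟩
  have hmap := (h.hasCenteredGaussianLaw_residual hσ a).map_eval (Sum.inl x)
  rw [Matrix.fromBlocks_apply₁₁, Matrix.mul_assoc] at hmap
  exact hmap

theorem indepFun_residual_fixedObs (h : IsGPModel P k σ f ε) (hσ : σ ≠ 0) (a : Fin t → X) :
    IndepFun (fun ω x => residual k σ f ε a x ω) (fixedObs f ε a) P :=
  (h.hasCenteredGaussianLaw_residual hσ a).indepFun_of_fromBlocks

end IsGPModel

end Residual

section Independence

variable {Ω α β γ : Type*} [MeasurableSpace Ω] [MeasurableSpace α] [MeasurableSpace β]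
  [MeasurableSpace γ] {P : Measure Ω} [IsProbabilityMeasure P] {A : Ω → α} {B : Ω → β} {C : Ω → γ}

theorem indepFun_prodMk_of_indepFun (hA : AEMeasurable A P) (hB : AEMeasurable B P)
    (hC : AEMeasurable C P) (hAB : IndepFun A B P) (hABC : IndepFun (fun ω => (A ω, B ω)) C P) :
    IndepFun A (fun ω => (B ω, C ω)) P := by
  have hBC : IndepFun B C P := hABC.comp measurable_snd measurable_id
  rw [indepFun_iff_map_prod_eq_prod_map_map hA (hB.prodMk hC),
    (indepFun_iff_map_prod_eq_prod_map_map hB hC).1 hBC, ← Measure.prodAssoc_prod,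
    ← (indepFun_iff_map_prod_eq_prod_map_map hA hB).1 hAB,
    ← (indepFun_iff_map_prod_eq_prod_map_map (hA.prodMk hB) hC).1 hABC,
    AEMeasurable.map_map_of_aemeasurable MeasurableEquiv.prodAssoc.measurable.aemeasurable
      ((hA.prodMk hB).prodMk hC)]
  rfl

variable {g : α → β → ℝ} {h : α → γ → ℝ}

theorem integrable_uncurry_map_prod (hA : AEMeasurable A P) (hB : AEMeasurable B P)
    (hAB : IndepFun A B P) (hg : Measurable g.uncurry)
    (hgi : Integrable (fun ω => g (A ω) (B ω)) P) :
    Integrable g.uncurry ((P.map A).prod (P.map B)) := by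
  rw [← (indepFun_iff_map_prod_eq_prod_map_map hA hB).1 hAB]
  exact (integrable_map_measure hg.aestronglyMeasurable (hA.prodMk hB)).2 hgi

theorem integrable_integral_of_indepFun (hA : AEMeasurable A P) (hB : AEMeasurable B P)
    (hAB : IndepFun A B P) (hg : Measurable g.uncurry)
    (hgi : Integrable (fun ω => g (A ω) (B ω)) P) :
    Integrable (fun w => ∫ ω, g w (B ω) ∂P) (P.map A) := by
  have hint : Integrable g.uncurry ((P.map A).prod (P.map B)) :=
    integrable_uncurry_map_prod hA hB hAB hg hgi
  refine hint.integral_prod_left.congr (.of_forall fun w => integral_map hB ?_)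
  exact (hg.comp measurable_prodMk_left).aestronglyMeasurable

theorem setIntegral_preimage_of_indepFun (hA : Measurable A) (hB : AEMeasurable B P)
    (hAB : IndepFun A B P) (hg : Measurable g.uncurry)
    (hgi : Integrable (fun ω => g (A ω) (B ω)) P) {S : Set α} (hS : MeasurableSet S) :
    ∫ ω in A ⁻¹' S, g (A ω) (B ω) ∂P = ∫ w in S, ∫ ω, g w (B ω) ∂P ∂P.map A := by
  have hAB' := hA.aemeasurable.prodMk hB
  have hint := integrable_uncurry_map_prod hA.aemeasurable hB hAB hg hgi
  calc ∫ ω in A ⁻¹' S, g (A ω) (B ω) ∂P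
      = ∫ p in S ×ˢ Set.univ, g.uncurry p ∂P.map fun ω => (A ω, B ω) := by
        rw [setIntegral_map (hS.prod .univ) hg.aestronglyMeasurable hAB']
        simp only [Set.mk_preimage_prod, Set.preimage_univ, Set.inter_univ]
        rfl
    _ = ∫ w in S, ∫ y, g w y ∂P.map B ∂P.map A := by
        rw [(indepFun_iff_map_prod_eq_prod_map_map hA.aemeasurable hB).1 hAB,
          setIntegral_prod _ hint.integrableOn, Measure.restrict_univ]
        rfl
    _ = _ := by
        refine integral_congr_ae (.of_forall fun w => integral_map hB ?_)
        exact (hg.comp measurable_prodMk_left).aestronglyMeasurable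

theorem setIntegral_le_setIntegral_of_indepFun (hA : Measurable A) (hB : AEMeasurable B P)
    (hC : AEMeasurable C P) (hAB : IndepFun A B P) (hAC : IndepFun A C P)
    (hg : Measurable g.uncurry) (hh : Measurable h.uncurry)
    (hgi : Integrable (fun ω => g (A ω) (B ω)) P) (hhi : Integrable (fun ω => h (A ω) (C ω)) P)
    (hle : ∀ w, ∫ ω, g w (B ω) ∂P ≤ ∫ ω, h w (C ω) ∂P) {E : Set Ω}
    (hE : MeasurableSet[MeasurableSpace.comap A inferInstance] E) :
    ∫ ω in E, g (A ω) (B ω) ∂P ≤ ∫ ω in E, h (A ω) (C ω) ∂P := by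
  obtain ⟨S, hS, rfl⟩ := hE
  rw [setIntegral_preimage_of_indepFun hA hB hAB hg hgi hS,
    setIntegral_preimage_of_indepFun hA hC hAC hh hhi hS]
  exact setIntegral_mono
    (integrable_integral_of_indepFun hA.aemeasurable hB hAB hg hgi).integrableOn
    (integrable_integral_of_indepFun hA.aemeasurable hC hAC hh hhi).integrableOn hle

theorem setIntegral_of_indepFun {R : Ω → ℝ} (hA : Measurable A) (hR : Integrable R P)
    (hAR : IndepFun A R P) {E : Set Ω}
    (hE : MeasurableSet[MeasurableSpace.comap A inferInstance] E) :
    ∫ ω in E, R ω ∂P = P.real E * ∫ ω, R ω ∂P := by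
  obtain ⟨S, hS, rfl⟩ := hE
  rw [setIntegral_preimage_of_indepFun (g := fun _ r => r) hA hR.aemeasurable hAR
    measurable_snd hR hS, setIntegral_const, map_measureReal_apply hA hS, smul_eq_mul]

end Independence

section Selection

variable {Ω X : Type*} [MeasurableSpace Ω] [MeasurableSpace X] [MeasurableSingletonClass X]
  {P : Measure Ω} {x : Ω → X} {g : X → Ω → ℝ}

theorem measurable_apply_self [Countable X] (hg : ∀ b, Measurable (g b)) (hx : Measurable x) :
    Measurable fun ω => g (x ω) ω :=
  (measurable_from_prod_countable_left (f := fun p : Ω × X => g p.2 p.1) hg).comp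
    (measurable_id.prodMk hx)

theorem integrable_apply_self [Finite X] (hg : ∀ b, Measurable (g b))
    (hgi : ∀ b, Integrable (g b) P) (hx : Measurable x) : Integrable (fun ω => g (x ω) ω) P := by
  have := Fintype.ofFinite X
  refine (integrable_finsetSum Finset.univ fun b _ => (hgi b).abs).mono'
    (measurable_apply_self hg hx).aestronglyMeasurable (.of_forall fun ω => ?_)
  exact Finset.single_le_sum (f := fun b => |g b ω|) (fun _ _ => abs_nonneg _)
    (Finset.mem_univ (x ω))

theorem integral_eq_sum_setIntegral_fiber [Fintype X] {g : Ω → ℝ} (hg : Integrable g P)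
    (hx : Measurable x) : ∫ ω, g ω ∂P = ∑ b, ∫ ω in x ⁻¹' {b}, g ω ∂P := by
  rw [← integral_iUnion_fintype (fun b => hx (measurableSet_singleton b))
    (fun b c hbc => (Set.disjoint_singleton.2 hbc).preimage x) fun b => hg.integrableOn,
    ← Set.preimage_iUnion, Set.iUnion_of_singleton, Set.preimage_univ, Measure.restrict_univ]

end Selection

section Algorithm

variable {Ω X 𝒰 : Type*} {k : X → X → ℝ} {σ s lam : ℝ} {f : X → Ω → ℝ} {ε ζ : ℕ → Ω → ℝ}
  {U : Ω → 𝒰} {x : ℕ → Ω → X} {t : ℕ}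

/-- The internal randomness of the algorithm: `U` and the first `n` of the `ζᵢ`. -/
def seed (ζ : ℕ → Ω → ℝ) (U : Ω → 𝒰) (n : ℕ) (ω : Ω) : 𝒰 × (Fin n → ℝ) :=
  (U ω, fun i => ζ i ω)

/-- What a run of the algorithm has seen if it queried the points `a`, which are fixed in advance.
Unlike `history`, it does not involve the queries themselves, so its independence of other random
variables can be read off the model. -/
def transcript (f : X → Ω → ℝ) (ε ζ : ℕ → Ω → ℝ) (U : Ω → 𝒰) (n : ℕ) {t : ℕ} (a : Fin t → X)
    (ω : Ω) : (𝒰 × (Fin n → ℝ)) × (Fin t → ℝ) :=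
  (seed ζ U n ω, fixedObs f ε a ω)

/-- The first `t` queries. -/
def queries (x : ℕ → Ω → X) (t : ℕ) (ω : Ω) (i : Fin t) : X :=
  x i ω

theorem queries_succ_preimage (a : Fin (t + 1) → X) :
    queries x (t + 1) ⁻¹' {a} = queries x t ⁻¹' {Fin.init a} ∩ x t ⁻¹' {a (Fin.last t)} := by
  ext ω
  simp [funext_iff, Fin.forall_fin_succ', queries, Fin.init]

theorem obs_eq_fixedObs {ω : Ω} {a : Fin t → X} (hω : queries x t ω = a) :
    (fun i : Fin t => obs f ε x i ω) = fixedObs f ε a ω := by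
  subst hω
  rfl

theorem history_eq_of_queries_eq {ω : Ω} {a : Fin t → X} (hω : queries x t ω = a) :
    history f ε ζ U x t ω = ((transcript f ε ζ U (t + 1) a ω).1.1,
      (transcript f ε ζ U (t + 1) a ω).1.2, a, (transcript f ε ζ U (t + 1) a ω).2) := by
  subst hω
  rfl

theorem comap_transcript_le [MeasurableSpace 𝒰] {m n u : ℕ} (hmn : m ≤ n) (htu : t ≤ u)
    (a : Fin u → X) :
    MeasurableSpace.comap (transcript f ε ζ U m fun i : Fin t => a (i.castLE htu)) inferInstance ≤
      MeasurableSpace.comap (transcript f ε ζ U n a) inferInstance := by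
  have hφ : Measurable fun p : (𝒰 × (Fin n → ℝ)) × (Fin u → ℝ) =>
      ((p.1.1, fun i : Fin m => p.1.2 (i.castLE hmn)), fun i : Fin t => p.2 (i.castLE htu)) := by
    fun_prop
  exact (hφ.comp (comap_measurable (transcript f ε ζ U n a))).comap_le

namespace IsIRGPUCB

variable [MeasurableSpace Ω] [MeasurableSpace 𝒰] [MeasurableSpace X] {P : Measure Ω}

theorem measurable_seed (h : IsIRGPUCB P k σ s lam f ε ζ U x) (n : ℕ) : Measurable (seed ζ U n) :=
  h.measurable_U.prodMk (measurable_pi_lambda _ fun _ => h.measurable_zeta _)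

theorem measurable_transcript (h : IsIRGPUCB P k σ s lam f ε ζ U x) (hm : IsGPModel P k σ f ε)
    (n : ℕ) (a : Fin t → X) : Measurable (transcript f ε ζ U n a) :=
  (h.measurable_seed n).prodMk (hm.measurable_fixedObs a)

theorem indepFun_transcript_residual [Finite X] [IsProbabilityMeasure P]
    (h : IsIRGPUCB P k σ s lam f ε ζ U x) (hm : IsGPModel P k σ f ε) (hσ : σ ≠ 0) (n : ℕ)
    (a : Fin t → X) :
    IndepFun (transcript f ε ζ U n a) (fun ω b => residual k σ f ε a b ω) P := by
  have : Measurable fun p : (X → ℝ) × (ℕ → ℝ) => fun i : Fin t => p.1 (a i) + p.2 i := by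
    fun_prop
  have hφ : Measurable fun p : (X → ℝ) × (ℕ → ℝ) =>
      ((fun b => p.1 b - postMean k σ a (fun i : Fin t => p.1 (a i) + p.2 i) b),
        fun i : Fin t => p.1 (a i) + p.2 i) := by
    fun_prop
  have hψ : Measurable fun p : (ℕ → ℝ) × 𝒰 => (p.2, fun i : Fin n => p.1 i) := by fun_prop
  have henv : IndepFun (fun ω => ((fun b => residual k σ f ε a b ω), fixedObs f ε a ω))
      (seed ζ U n) P := h.indep_env.comp hφ hψ
  exact ((indepFun_prodMk_of_indepFun
    (measurable_pi_lambda _ fun b => hm.measurable_residual a b).aemeasurable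
    (hm.measurable_fixedObs a).aemeasurable (h.measurable_seed n).aemeasurable
    (hm.indepFun_residual_fixedObs hσ a) henv).comp measurable_id measurable_swap).symm

variable [IsProbabilityMeasure P] in
theorem indepFun_zeta_seed (h : IsIRGPUCB P k σ s lam f ε ζ U x) (t : ℕ) :
    IndepFun (ζ t) (seed ζ U t) P := by
  have hpast : Measurable fun ω => fun i : Fin t => ζ i ω :=
    measurable_pi_lambda _ fun _ => h.measurable_zeta _
  have hζ : IndepFun (ζ t) (fun ω (i : Fin t) => ζ i ω) P :=
    (h.iIndep_zeta.indepFun_finset {t} (Finset.range t) (by simp) h.measurable_zeta).comp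
      (φ := fun z : ({t} : Finset ℕ) → ℝ => z ⟨t, Finset.mem_singleton_self t⟩)
      (ψ := fun (z : Finset.range t → ℝ) (i : Fin t) => z ⟨i, Finset.mem_range.2 i.2⟩)
      (by fun_prop) (by fun_prop)
  have hU : IndepFun (fun ω => (ζ t ω, fun i : Fin t => ζ i ω)) U P :=
    h.indep_zeta_U.comp (φ := fun z : ℕ → ℝ => (z t, fun i : Fin t => z i)) (ψ := id)
      (by fun_prop) measurable_id
  exact (indepFun_prodMk_of_indepFun (h.measurable_zeta t).aemeasurable hpast.aemeasurable
    h.measurable_U.aemeasurable hζ hU).comp measurable_id measurable_swap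

theorem indepFun_transcript_zeta [IsProbabilityMeasure P] (h : IsIRGPUCB P k σ s lam f ε ζ U x)
    (hm : IsGPModel P k σ f ε) (a : Fin t → X) :
    IndepFun (transcript f ε ζ U t a) (ζ t) P := by
  have henv : IndepFun (fun ω => (ζ t ω, seed ζ U t ω)) (fixedObs f ε a) P :=
    (h.indep_env.comp (φ := fun p : (X → ℝ) × (ℕ → ℝ) => fun i : Fin t => p.1 (a i) + p.2 i)
      (ψ := fun p : (ℕ → ℝ) × 𝒰 => (p.1 t, p.2, fun i : Fin t => p.1 i))
      (by fun_prop) (by fun_prop)).symm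
  exact (indepFun_prodMk_of_indepFun (h.measurable_zeta t).aemeasurable
    (h.measurable_seed t).aemeasurable (hm.measurable_fixedObs a).aemeasurable
    (h.indepFun_zeta_seed t) henv).symm

variable [MeasurableSingletonClass X]

theorem measurableSet_comap_transcript_inter_query (h : IsIRGPUCB P k σ s lam f ε ζ U x)
    {a : Fin t → X} (b : X)
    (ha : MeasurableSet[MeasurableSpace.comap (transcript f ε ζ U t a) inferInstance]
      (queries x t ⁻¹' {a})) :
    MeasurableSet[MeasurableSpace.comap (transcript f ε ζ U (t + 1) a) inferInstance]
      (queries x t ⁻¹' {a} ∩ x t ⁻¹' {b}) := by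
  obtain ⟨Q, hQ, hxQ⟩ := h.nonanticipating t (measurableSet_singleton b)
  have hφ : Measurable fun p : (𝒰 × (Fin (t + 1) → ℝ)) × (Fin t → ℝ) => (p.1.1, p.1.2, a, p.2) := by
    fun_prop
  have hinter : queries x t ⁻¹' {a} ∩ x t ⁻¹' {b} = queries x t ⁻¹' {a} ∩
      transcript f ε ζ U (t + 1) a ⁻¹' ((fun p => (p.1.1, p.1.2, a, p.2)) ⁻¹' Q) := by
    rw [← hxQ]
    ext ω
    refine and_congr_right fun hω => ?_
    rw [Set.mem_preimage, history_eq_of_queries_eq hω]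
    rfl
  rw [hinter]
  exact (comap_transcript_le t.le_succ le_rfl a _ ha).inter ⟨_, hφ hQ, rfl⟩

theorem measurableSet_comap_transcript_queries (h : IsIRGPUCB P k σ s lam f ε ζ U x)
    (a : Fin t → X) :
    MeasurableSet[MeasurableSpace.comap (transcript f ε ζ U t a) inferInstance]
      (queries x t ⁻¹' {a}) := by
  induction t with
  | zero =>
    rw [show queries x 0 ⁻¹' {a} = Set.univ from Set.eq_univ_of_forall fun ω =>
      Subsingleton.elim _ a]
    exact MeasurableSet.univ
  | succ t ih =>
    rw [queries_succ_preimage]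
    exact comap_transcript_le le_rfl t.le_succ a _
      (h.measurableSet_comap_transcript_inter_query _ (ih (Fin.init a)))

theorem measurable_query [Countable X] (h : IsIRGPUCB P k σ s lam f ε ζ U x)
    (hm : IsGPModel P k σ f ε) (t : ℕ) : Measurable (x t) := by
  induction t using Nat.strong_induction_on with
  | _ t ih =>
    have hζ : Measurable fun ω (i : Fin (t + 1)) => ζ i ω :=
      measurable_pi_lambda _ fun i => h.measurable_zeta i
    have hpast : Measurable fun ω (i : Fin t) => x i ω := measurable_pi_lambda _ fun i => ih i i.2
    have hobs : Measurable fun ω (i : Fin t) => obs f ε x i ω := measurable_pi_lambda _ fun i =>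
      (measurable_apply_self hm.measurable_f (ih i i.2)).add (hm.measurable_noise i)
    have hhist : Measurable (history f ε ζ U x t) :=
      h.measurable_U.prodMk (hζ.prodMk (hpast.prodMk hobs))
    exact (h.nonanticipating t).mono hhist.comap_le le_rfl

theorem measurable_queries [Countable X] (h : IsIRGPUCB P k σ s lam f ε ζ U x)
    (hm : IsGPModel P k σ f ε) (t : ℕ) : Measurable (queries x t) :=
  measurable_pi_lambda _ fun i => h.measurable_query hm i

theorem setIntegral_residual_query [Finite X] [IsProbabilityMeasure P]
    (h : IsIRGPUCB P k σ s lam f ε ζ U x) (hm : IsGPModel P k σ f ε) (hσ : σ ≠ 0)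
    (a : Fin t → X) :
    ∫ ω in queries x t ⁻¹' {a}, residual k σ f ε a (x t ω) ω ∂P = 0 := by
  have := Fintype.ofFinite X
  have hx := h.measurable_query hm t
  have hlaw := hm.hasCenteredGaussianLaw_residual hσ a
  have hRi (b : X) : Integrable (residual k σ f ε a b) P := hlaw.integrable (Sum.inl b)
  have hmean (b : X) : ∫ ω, residual k σ f ε a b ω ∂P = 0 := hlaw.integral_eq_zero (Sum.inl b)
  have hRx : Integrable (fun ω => residual k σ f ε a (x t ω) ω) P :=
    integrable_apply_self (hm.measurable_residual a) hRi hx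
  rw [integral_eq_sum_setIntegral_fiber hRx.integrableOn hx]
  refine Finset.sum_eq_zero fun b _ => ?_
  have hfib := hx (measurableSet_singleton b)
  have hqb := h.measurableSet_comap_transcript_inter_query b
    (h.measurableSet_comap_transcript_queries a)
  calc ∫ ω in x t ⁻¹' {b}, residual k σ f ε a (x t ω) ω ∂P.restrict (queries x t ⁻¹' {a})
      = ∫ ω in queries x t ⁻¹' {a} ∩ x t ⁻¹' {b}, residual k σ f ε a b ω ∂P := by
        rw [Measure.restrict_restrict hfib, Set.inter_comm]
        refine setIntegral_congr_fun
          ((h.measurable_queries hm t (measurableSet_singleton a)).inter hfib) fun ω hω => ?_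
        exact congrArg (fun c => residual k σ f ε a c ω) hω.2
    _ = 0 := by
        rw [setIntegral_of_indepFun (h.measurable_transcript hm (t + 1) a) (hRi b)
          ((h.indepFun_transcript_residual hm hσ (t + 1) a).comp measurable_id
            (measurable_pi_apply b)) hqb, hmean, mul_zero]

end IsIRGPUCB

end Algorithm

theorem integral_sqrt_mul_sqrt_le {Ω : Type*} [MeasurableSpace Ω] {P : Measure Ω} {u v : Ω → ℝ}
    (hu₀ : 0 ≤ᵐ[P] u) (hv₀ : 0 ≤ᵐ[P] v) (hu : MemLp (fun ω => √(u ω)) 2 P)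
    (hv : MemLp (fun ω => √(v ω)) 2 P) :
    ∫ ω, √(u ω) * √(v ω) ∂P ≤ √(∫ ω, u ω ∂P) * √(∫ ω, v ω ∂P) := by
  have hsq {w : Ω → ℝ} (hw : 0 ≤ᵐ[P] w) : ∫ ω, √(w ω) ^ (2 : ℝ) ∂P = ∫ ω, w ω ∂P :=
    integral_congr_ae (hw.mono fun ω hω => by simp [Real.sq_sqrt hω])
  have hCS := integral_mul_le_Lp_mul_Lq_of_nonneg (μ := P) (p := 2) (q := 2) .two_two
    (.of_forall fun ω => Real.sqrt_nonneg (u ω)) (.of_forall fun ω => Real.sqrt_nonneg (v ω))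
    (by simpa using hu) (by simpa using hv)
  rwa [hsq hu₀, hsq hv₀, ← Real.sqrt_eq_rpow, ← Real.sqrt_eq_rpow] at hCS

section Regret

variable {Ω X 𝒰 : Type*} {k : X → X → ℝ} {σ s lam : ℝ} {f : X → Ω → ℝ} {ε ζ : ℕ → Ω → ℝ}
  {U : Ω → 𝒰} {x : ℕ → Ω → X} {t : ℕ}

/-- The posterior variance at the point that is queried next. -/
noncomputable def queryVar (k : X → X → ℝ) (σ : ℝ) (x : ℕ → Ω → X) (t : ℕ) (ω : Ω) : ℝ :=
  postVar k σ (queries x t ω) (x t ω)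

theorem simpleRegret_le_sub {T : ℕ} (ht : t < T) (ω : Ω) :
    simpleRegret f x T ω ≤ (⨆ b, f b ω) - f (x t ω) ω :=
  sub_le_sub_left (Finite.le_ciSup (fun i : Fin T => f (x i ω) ω) ⟨t, ht⟩) _

theorem postMean_add_residual (a : Fin t → X) (b : X) (ω : Ω) :
    postMean k σ a (fixedObs f ε a ω) b + residual k σ f ε a b ω = f b ω :=
  add_sub_cancel _ _

namespace IsIRGPUCB

variable [MeasurableSpace Ω] [MeasurableSpace 𝒰] [MeasurableSpace X] {P : Measure Ω}

theorem memLp_sqrt_zeta (h : IsIRGPUCB P k σ s lam f ε ζ U x) (hlam : 0 < lam) (t : ℕ) :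
    MemLp (fun ω => √(ζ t ω)) 2 P :=
  ((h.law_zeta t).map_eq ▸ memLp_sqrt_twoParamExp s hlam).comp_of_map (h.law_zeta t).aemeasurable

theorem integral_zeta (h : IsIRGPUCB P k σ s lam f ε ζ U x) (hlam : 0 < lam) (t : ℕ) :
    ∫ ω, ζ t ω ∂P = s + lam⁻¹ :=
  (h.law_zeta t).integral_eq.trans (integral_id_twoParamExp s hlam)

theorem ae_lt_zeta (h : IsIRGPUCB P k σ s lam f ε ζ U x) (hlam : 0 < lam) (t : ℕ) :
    ∀ᵐ ω ∂P, s < ζ t ω :=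
  ((h.law_zeta t).ae_iff (measurableSet_Ioi (a := s)).mem).2 (ae_lt_twoParamExp s hlam)

theorem iSup_ucb_eq [Finite X] (h : IsIRGPUCB P k σ s lam f ε ζ U x) {a : Fin t → X} {ω : Ω}
    (hω : queries x t ω = a) :
    ⨆ b, ucb k σ a (fixedObs f ε a ω) (ζ t ω) b = f (x t ω) ω +
      √(ζ t ω) * √(queryVar k σ x t ω) - residual k σ f ε a (x t ω) ω := by
  have hmax (b : X) : ucb k σ a (fixedObs f ε a ω) (ζ t ω) b ≤
      ucb k σ a (fixedObs f ε a ω) (ζ t ω) (x t ω) := by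
    rw [← hω, ← obs_eq_fixedObs rfl]
    exact h.argmax t ω b
  have : Nonempty X := ⟨x t ω⟩
  rw [le_antisymm (ciSup_le hmax) (Finite.le_ciSup _ (x t ω)), ucb, queryVar, hω,
    ← postMean_add_residual (k := k) (σ := σ) (f := f) (ε := ε) a (x t ω) ω]
  ring

section Comparison

variable [IsProbabilityMeasure P] [Nonempty X]

theorem integrable_iSup_ucb [Finite X] (h : IsIRGPUCB P k σ s lam f ε ζ U x)
    (hm : IsGPModel P k σ f ε) (hσ : σ ≠ 0) (hlam : 0 < lam) (a : Fin t → X) :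
    Integrable (fun ω => ⨆ b, ucb k σ a (fixedObs f ε a ω) (ζ t ω) b) P := by
  refine integrable_iSup_of_finite fun b => ?_
  have hmean : Integrable (fun ω => postMean k σ a (fixedObs f ε a ω) b) P := by
    refine (((hm.hasCenteredGaussianLaw_comp id).integrable b).sub
      ((hm.hasCenteredGaussianLaw_residual hσ a).integrable (Sum.inl b))).congr
      (.of_forall fun ω => sub_sub_cancel _ _)
  exact hmean.add (((h.memLp_sqrt_zeta hlam t).integrable one_le_two).mul_const _)

variable [Fintype X]

theorem integral_iSup_postMean_add_residual_le (h : IsIRGPUCB P k σ s lam f ε ζ U x)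
    (hm : IsGPModel P k σ f ε) (hσ : σ ≠ 0) (hlam : 0 < lam) (hlam' : lam ≤ 1 / 2) (hs₀ : 0 ≤ s)
    (hs : 2 * Real.log (Fintype.card X / 2) ≤ s) (a : Fin t → X) (y : Fin t → ℝ) :
    ∫ ω, ⨆ b, (postMean k σ a y b + residual k σ f ε a b ω) ∂P ≤
      ∫ ω, ⨆ b, ucb k σ a y (ζ t ω) b ∂P := by
  have hvar (b : X) := Real.coe_toNNReal _ (postVar_nonneg hm.posSemidef hσ a b)
  calc ∫ ω, ⨆ b, (postMean k σ a y b + residual k σ f ε a b ω) ∂P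
      ≤ ∫ z, ⨆ b, (postMean k σ a y b + √z * √(postVar k σ a b).toNNReal) ∂twoParamExp s lam :=
        integral_iSup_le_integral_iSup_ucb (postMean k σ a y) _ (hm.hasLaw_residual hσ a) hs₀ hs
          hlam hlam'
    _ = ∫ ω, ⨆ b, (postMean k σ a y b + √(ζ t ω) * √(postVar k σ a b).toNNReal) ∂P :=
        ((h.law_zeta t).integral_comp
          (integrable_iSup_ucb_twoParamExp _ _ hlam).aestronglyMeasurable).symm
    _ = ∫ ω, ⨆ b, ucb k σ a y (ζ t ω) b ∂P := by simp only [hvar, ucb]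

theorem setIntegral_iSup_le_setIntegral_iSup_ucb (h : IsIRGPUCB P k σ s lam f ε ζ U x)
    (hm : IsGPModel P k σ f ε) (hσ : σ ≠ 0) (hlam : 0 < lam) (hlam' : lam ≤ 1 / 2) (hs₀ : 0 ≤ s)
    (hs : 2 * Real.log (Fintype.card X / 2) ≤ s) (a : Fin t → X) {E : Set Ω}
    (hE : MeasurableSet[MeasurableSpace.comap (transcript f ε ζ U t a) inferInstance] E) :
    ∫ ω in E, ⨆ b, f b ω ∂P ≤
      ∫ ω in E, ⨆ b, ucb k σ a (fixedObs f ε a ω) (ζ t ω) b ∂P := by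
  have hsup (ω : Ω) : ⨆ b, f b ω =
      ⨆ b, (postMean k σ a (fixedObs f ε a ω) b + residual k σ f ε a b ω) :=
    iSup_congr fun b => (postMean_add_residual a b ω).symm
  have hfi : Integrable (fun ω => ⨆ b, f b ω) P :=
    integrable_iSup_of_finite fun b => (hm.hasCenteredGaussianLaw_comp id).integrable b
  let g (w : (𝒰 × (Fin t → ℝ)) × (Fin t → ℝ)) (r : X → ℝ) : ℝ := ⨆ b, (postMean k σ a w.2 b + r b)
  let u (w : (𝒰 × (Fin t → ℝ)) × (Fin t → ℝ)) (z : ℝ) : ℝ := ⨆ b, ucb k σ a w.2 z b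
  have hg : Measurable g.uncurry := Measurable.iSup fun b => by fun_prop
  have hu : Measurable u.uncurry := Measurable.iSup fun b => by
    unfold ucb
    fun_prop
  simp only [hsup] at hfi ⊢
  exact setIntegral_le_setIntegral_of_indepFun (g := g) (h := u) (h.measurable_transcript hm t a)
    (measurable_pi_lambda _ fun b => hm.measurable_residual a b).aemeasurable
    (h.measurable_zeta t).aemeasurable (h.indepFun_transcript_residual hm hσ t a)
    (h.indepFun_transcript_zeta hm a) hg hu hfi (h.integrable_iSup_ucb hm hσ hlam a)
    (fun w => h.integral_iSup_postMean_add_residual_le hm hσ hlam hlam' hs₀ hs a w.2) hE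

end Comparison

variable [MeasurableSingletonClass X]

section Integrability

variable [Finite X]

theorem integrable_apply_query (h : IsIRGPUCB P k σ s lam f ε ζ U x)
    (hm : IsGPModel P k σ f ε) (t : ℕ) : Integrable (fun ω => f (x t ω) ω) P :=
  integrable_apply_self hm.measurable_f
    (hm.hasCenteredGaussianLaw_comp id).integrable (h.measurable_query hm t)

theorem measurable_queryVar (h : IsIRGPUCB P k σ s lam f ε ζ U x)
    (hm : IsGPModel P k σ f ε) (t : ℕ) : Measurable (queryVar k σ x t) :=
  (Measurable.of_discrete (f := fun p : (Fin t → X) × X => postVar k σ p.1 p.2)).comp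
    ((h.measurable_queries hm t).prodMk (h.measurable_query hm t))

theorem integrable_simpleRegret [Nonempty X] (h : IsIRGPUCB P k σ s lam f ε ζ U x)
    (hm : IsGPModel P k σ f ε) {T : ℕ} (hT : 0 < T) : Integrable (simpleRegret f x T) P := by
  have : Nonempty (Fin T) := ⟨⟨0, hT⟩⟩
  exact (integrable_iSup_of_finite (hm.hasCenteredGaussianLaw_comp id).integrable).sub
    (integrable_iSup_of_finite fun t : Fin T => h.integrable_apply_query hm t)

variable [IsProbabilityMeasure P]

theorem memLp_sqrt_queryVar (h : IsIRGPUCB P k σ s lam f ε ζ U x) (hm : IsGPModel P k σ f ε)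
    (hσ : σ ≠ 0) (hk : ∀ b, k b b ≤ 1) (t : ℕ) : MemLp (fun ω => √(queryVar k σ x t ω)) 2 P := by
  refine .of_bound (h.measurable_queryVar hm t).sqrt.aestronglyMeasurable 1 (.of_forall fun ω => ?_)
  rw [Real.norm_of_nonneg (Real.sqrt_nonneg _), Real.sqrt_le_one]
  exact (postVar_le hm.posSemidef hσ _ _).trans (hk _)

theorem integrable_queryVar (h : IsIRGPUCB P k σ s lam f ε ζ U x) (hm : IsGPModel P k σ f ε)
    (hσ : σ ≠ 0) (hk : ∀ b, k b b ≤ 1) (t : ℕ) : Integrable (queryVar k σ x t) P :=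
  (h.memLp_sqrt_queryVar hm hσ hk t).integrable_sq.congr
    (.of_forall fun _ => Real.sq_sqrt (postVar_nonneg hm.posSemidef hσ _ _))

theorem integrable_sqrt_zeta_mul_sqrt_queryVar (h : IsIRGPUCB P k σ s lam f ε ζ U x)
    (hm : IsGPModel P k σ f ε) (hσ : σ ≠ 0) (hk : ∀ b, k b b ≤ 1) (hlam : 0 < lam) (t : ℕ) :
    Integrable (fun ω => √(ζ t ω) * √(queryVar k σ x t ω)) P :=
  (h.memLp_sqrt_zeta hlam t).integrable_mul (h.memLp_sqrt_queryVar hm hσ hk t)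

theorem sum_integral_queryVar_le (h : IsIRGPUCB P k σ s lam f ε ζ U x) (hm : IsGPModel P k σ f ε)
    (hσ : σ ≠ 0) (hk : ∀ b, k b b ≤ 1) (T : ℕ) :
    ∑ t ∈ Finset.range T, ∫ ω, queryVar k σ x t ω ∂P ≤
      2 / Real.log (1 + (σ ^ 2)⁻¹) * (maxInfoGain P f ε T).toReal := by
  have hint := fun t (_ : t ∈ Finset.range T) => h.integrable_queryVar hm hσ hk t
  have hlog : 0 ≤ Real.log (1 + (σ ^ 2)⁻¹) :=
    Real.log_nonneg (le_add_of_nonneg_right (by positivity))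
  rw [← integral_finsetSum _ hint]
  refine (integral_mono (integrable_finsetSum _ hint) (integrable_const _) fun ω => ?_).trans_eq
    (by rw [integral_const, probReal_univ, one_smul])
  refine (sum_postVar_le hm.posSemidef hk hσ (fun t => x t ω) T).trans ?_
  gcongr
  exact hm.infoGain_le_maxInfoGain hσ _

end Integrability

variable [IsProbabilityMeasure P] [Fintype X] [Nonempty X]

theorem setIntegral_iSup_le (h : IsIRGPUCB P k σ s lam f ε ζ U x) (hm : IsGPModel P k σ f ε)
    (hσ : σ ≠ 0) (hk : ∀ b, k b b ≤ 1) (hlam : 0 < lam) (hlam' : lam ≤ 1 / 2) (hs₀ : 0 ≤ s)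
    (hs : 2 * Real.log (Fintype.card X / 2) ≤ s) (a : Fin t → X) :
    ∫ ω in queries x t ⁻¹' {a}, ⨆ b, f b ω ∂P ≤
      ∫ ω in queries x t ⁻¹' {a}, (f (x t ω) ω + √(ζ t ω) * √(queryVar k σ x t ω)) ∂P := by
  have hR : Integrable (fun ω => residual k σ f ε a (x t ω) ω) P :=
    integrable_apply_self (hm.measurable_residual a)
      (fun b => (hm.hasCenteredGaussianLaw_residual hσ a).integrable (Sum.inl b))
      (h.measurable_query hm t)
  have hwidth : Integrable (fun ω => f (x t ω) ω + √(ζ t ω) * √(queryVar k σ x t ω)) P :=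
    (h.integrable_apply_query hm t).add (h.integrable_sqrt_zeta_mul_sqrt_queryVar hm hσ hk hlam t)
  calc ∫ ω in queries x t ⁻¹' {a}, ⨆ b, f b ω ∂P
      ≤ ∫ ω in queries x t ⁻¹' {a}, ⨆ b, ucb k σ a (fixedObs f ε a ω) (ζ t ω) b ∂P :=
        h.setIntegral_iSup_le_setIntegral_iSup_ucb hm hσ hlam hlam' hs₀ hs a
          (h.measurableSet_comap_transcript_queries a)
    _ = ∫ ω in queries x t ⁻¹' {a}, (f (x t ω) ω + √(ζ t ω) * √(queryVar k σ x t ω) -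
          residual k σ f ε a (x t ω) ω) ∂P :=
        setIntegral_congr_fun (h.measurable_queries hm t (measurableSet_singleton a))
          fun ω hω => h.iSup_ucb_eq hω
    _ = _ := by
        rw [integral_sub hwidth.integrableOn hR.integrableOn, h.setIntegral_residual_query hm hσ a,
          sub_zero]

theorem integral_iSup_sub_query_le (h : IsIRGPUCB P k σ s lam f ε ζ U x)
    (hm : IsGPModel P k σ f ε) (hσ : σ ≠ 0) (hk : ∀ b, k b b ≤ 1) (hlam : 0 < lam)
    (hlam' : lam ≤ 1 / 2) (hs₀ : 0 ≤ s) (hs : 2 * Real.log (Fintype.card X / 2) ≤ s) (t : ℕ) :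
    ∫ ω, ((⨆ b, f b ω) - f (x t ω) ω) ∂P ≤ ∫ ω, √(ζ t ω) * √(queryVar k σ x t ω) ∂P := by
  have hsup : Integrable (fun ω => ⨆ b, f b ω) P :=
    integrable_iSup_of_finite (hm.hasCenteredGaussianLaw_comp id).integrable
  have hfx := h.integrable_apply_query hm t
  have hwidth := h.integrable_sqrt_zeta_mul_sqrt_queryVar hm hσ hk hlam t
  have hucb : Integrable (fun ω => f (x t ω) ω + √(ζ t ω) * √(queryVar k σ x t ω)) P :=
    hfx.add hwidth
  have hq := h.measurable_queries hm t
  rw [integral_sub hsup hfx, sub_le_iff_le_add', ← integral_add hfx hwidth,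
    integral_eq_sum_setIntegral_fiber hsup hq,
    integral_eq_sum_setIntegral_fiber hucb hq]
  exact Finset.sum_le_sum fun a _ => h.setIntegral_iSup_le hm hσ hk hlam hlam' hs₀ hs a

theorem BSR_le_sqrt_mul_sqrt_integral_queryVar (h : IsIRGPUCB P k σ s lam f ε ζ U x)
    (hm : IsGPModel P k σ f ε) (hσ : σ ≠ 0) (hk : ∀ b, k b b ≤ 1) (hlam : 0 < lam)
    (hlam' : lam ≤ 1 / 2) (hs₀ : 0 ≤ s) (hs : 2 * Real.log (Fintype.card X / 2) ≤ s) {T : ℕ}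
    (ht : t < T) :
    BSR P f x T ≤ √(s + lam⁻¹) * √(∫ ω, queryVar k σ x t ω ∂P) := by
  have hsup : Integrable (fun ω => ⨆ b, f b ω) P :=
    integrable_iSup_of_finite (hm.hasCenteredGaussianLaw_comp id).integrable
  calc BSR P f x T
      ≤ ∫ ω, ((⨆ b, f b ω) - f (x t ω) ω) ∂P :=
        integral_mono (h.integrable_simpleRegret hm (t.zero_le.trans_lt ht))
          (hsup.sub (h.integrable_apply_query hm t)) (simpleRegret_le_sub ht)
    _ ≤ ∫ ω, √(ζ t ω) * √(queryVar k σ x t ω) ∂P :=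
        h.integral_iSup_sub_query_le hm hσ hk hlam hlam' hs₀ hs t
    _ ≤ √(∫ ω, ζ t ω ∂P) * √(∫ ω, queryVar k σ x t ω ∂P) :=
        integral_sqrt_mul_sqrt_le ((h.ae_lt_zeta hlam t).mono fun ω hω => hs₀.trans hω.le)
          (.of_forall fun ω => postVar_nonneg hm.posSemidef hσ _ _) (h.memLp_sqrt_zeta hlam t)
          (h.memLp_sqrt_queryVar hm hσ hk t)
    _ = √(s + lam⁻¹) * √(∫ ω, queryVar k σ x t ω ∂P) := by rw [h.integral_zeta hlam]

theorem BSR_le (h : IsIRGPUCB P k σ s lam f ε ζ U x) (hm : IsGPModel P k σ f ε) (hσ : σ ≠ 0)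
    (hk : ∀ b, k b b ≤ 1) (hlam : 0 < lam) (hlam' : lam ≤ 1 / 2) (hs₀ : 0 ≤ s)
    (hs : 2 * Real.log (Fintype.card X / 2) ≤ s) {T : ℕ} (hT : 0 < T) :
    BSR P f x T ≤
      √(2 / Real.log (1 + (σ ^ 2)⁻¹) * (s + lam⁻¹) * (maxInfoGain P f ε T).toReal / T) := by
  have hT' : (0 : ℝ) < T := by exact_mod_cast hT
  have hc : 0 ≤ s + lam⁻¹ := by positivity
  have hvar (t : ℕ) : 0 ≤ ∫ ω, queryVar k σ x t ω ∂P :=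
    integral_nonneg fun ω => postVar_nonneg hm.posSemidef hσ _ _
  have hsum : T * BSR P f x T ≤ √(T * (s + lam⁻¹)) *
      √(2 / Real.log (1 + (σ ^ 2)⁻¹) * (maxInfoGain P f ε T).toReal) := by
    calc T * BSR P f x T
        = ∑ _t ∈ Finset.range T, BSR P f x T := by simp
      _ ≤ ∑ t ∈ Finset.range T, √(s + lam⁻¹) * √(∫ ω, queryVar k σ x t ω ∂P) :=
          Finset.sum_le_sum fun t ht => h.BSR_le_sqrt_mul_sqrt_integral_queryVar hm hσ hk hlam
            hlam' hs₀ hs (Finset.mem_range.1 ht)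
      _ ≤ √(∑ _t ∈ Finset.range T, (s + lam⁻¹)) *
            √(∑ t ∈ Finset.range T, ∫ ω, queryVar k σ x t ω ∂P) :=
          Real.sum_sqrt_mul_sqrt_le _ (fun _ => hc) hvar
      _ ≤ _ := by
          rw [Finset.sum_const, Finset.card_range, nsmul_eq_mul]
          gcongr
          exact h.sum_integral_queryVar_le hm hσ hk T
  refine le_of_mul_le_mul_left (hsum.trans_eq ?_) hT'
  rw [← Real.sqrt_mul (by positivity), ← Real.sqrt_sq hT'.le, ← Real.sqrt_mul (by positivity),
    Real.sqrt_sq hT'.le]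
  congr 1
  field_simp

end IsIRGPUCB

theorem BSR_of_subsingleton [MeasurableSpace Ω] [Subsingleton X] (P : Measure Ω) (f : X → Ω → ℝ)
    (x : ℕ → Ω → X) {T : ℕ} (hT : 0 < T) : BSR P f x T = 0 := by
  have : Nonempty (Fin T) := ⟨⟨0, hT⟩⟩
  refine integral_eq_zero_of_ae (.of_forall fun ω => ?_)
  obtain ⟨a⟩ : Nonempty X := ⟨x 0 ω⟩
  have hf (b : X) : f b ω = f a ω := by rw [Subsingleton.elim b a]
  have : Nonempty X := ⟨a⟩
  simp [simpleRegret, hf]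

end Regret

end GPBandit

open GPBandit in
theorem corollary1_general {X Ω 𝒰 : Type*} [Fintype X] [Nonempty X] [MeasurableSpace X]
    [MeasurableSingletonClass X] [MeasurableSpace Ω] [MeasurableSpace 𝒰] (P : Measure Ω)
    [IsProbabilityMeasure P] (k : X → X → ℝ) (hk : ∀ x, k x x ≤ 1) (σ : ℝ) (hσ : σ ≠ 0)
    (f : X → Ω → ℝ) (ε ζ : ℕ → Ω → ℝ) (U : Ω → 𝒰) (x : ℕ → Ω → X) (s lam : ℝ) (hlam : 0 < lam)
    (hlam' : lam ≤ 1 / 2) (hs : 2 * Real.log (Fintype.card X / 2) ≤ s)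
    (hmodel : IsGPModel P k σ f ε) (halg : IsIRGPUCB P k σ s lam f ε ζ U x) (η : ℝ) (hη : 0 < η) :
    ∃ T : ℕ,
      IsLeast {n : ℕ | 0 < n ∧ √(2 / Real.log (1 + (σ ^ 2)⁻¹) * (s + lam⁻¹) *
        (maxInfoGain P f ε n).toReal / n) ≤ η} T ∧
      Integrable (simpleRegret f x T) P ∧ BSR P f x T ≤ η := by
  have hlim : Filter.Tendsto (fun n : ℕ => √(2 / Real.log (1 + (σ ^ 2)⁻¹) * (s + lam⁻¹) *
      (maxInfoGain P f ε n).toReal / n)) Filter.atTop (nhds 0) := by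
    simpa only [mul_div_assoc, mul_zero, Real.sqrt_zero] using ((hmodel.tendsto_maxInfoGain_div
      hσ).const_mul (2 / Real.log (1 + (σ ^ 2)⁻¹) * (s + lam⁻¹))).sqrt
  have hmem := Nat.sInf_mem
    ((Filter.eventually_gt_atTop 0).and (hlim.eventually_le_const hη)).exists
  refine ⟨_, ⟨hmem, fun n hn => Nat.sInf_le hn⟩, halg.integrable_simpleRegret hmodel hmem.1, ?_⟩
  rcases subsingleton_or_nontrivial X with _ | _
  · exact (BSR_of_subsingleton P f x hmem.1).trans_le hη.le
  · have hcard : (2 : ℝ) ≤ Fintype.card X := by exact_mod_cast Fintype.one_lt_card (α := X)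
    have hs₀ : 0 ≤ s := hs.trans' (mul_nonneg two_pos.le (Real.log_nonneg (by linarith)))
    exact (halg.BSR_le hmodel hσ hk hlam hlam' hs₀ hs hmem.1).trans hmem.2

theorem corollary1 {d : ℕ} (D : Finset (EuclideanSpace ℝ (Fin d))) (hD : D.Nonempty)
    {Ω 𝒰 : Type*} [MeasurableSpace Ω] [MeasurableSpace 𝒰] (P : Measure Ω) [IsProbabilityMeasure P]
    (k : D → D → ℝ) (hk : GPBandit.IsStationary k) (hk1 : ∀ x, k x x = 1)
    (σ : ℝ) (hσ : 0 < σ)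
    (f : D → Ω → ℝ) (ε ζ : ℕ → Ω → ℝ) (U : Ω → 𝒰) (x : ℕ → Ω → D)
    (s : ℝ) (hs : s = 2 * Real.log ((D.card : ℝ) / 2))
    (hmodel : GPBandit.IsGPModel P k σ f ε)
    (halg : GPBandit.IsIRGPUCB P k σ s (1 / 2) f ε ζ U x)
    (C₁ C₂ : ℝ) (hC₁ : C₁ = 2 / Real.log (1 + (σ ^ 2)⁻¹)) (hC₂ : C₂ = 2 + s)
    (η : ℝ) (hη : 0 < η) :
    ∃ T : ℕ,
      IsLeast {n : ℕ | 0 < n ∧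
        √(C₁ * C₂ * (GPBandit.maxInfoGain P f ε n).toReal / n) ≤ η} T ∧
      Integrable (GPBandit.simpleRegret f x T) P ∧
      GPBandit.BSR P f x T ≤ η := by
  have := hD.to_subtype
  subst hC₁ hC₂
  simpa [add_comm s] using corollary1_general P k (fun x => (hk1 x).le) σ hσ.ne' f ε ζ U x s (1 / 2)
    (by norm_num) le_rfl (by simp [hs]) hmodel halg η hη
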